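/- Fix integers $d\ge 1$, $n\ge 3$ and complex numbers $u\neq 0$, $z$, $x_1,\dots,x_{d-1}$; put $x_0:=1$ and read indices of the $x_j$ modulo $d$. Write $\exp(k):=e^{2\pi i k/d}$. For $k\ge 1$, the Yokonuma–Hecke algebra ${\rm Y}_{d,k}(u)$ is the unital associative ${\mathbb C}$-algebra generated by $g_1,\dots,g_{k-1},t_1,\dots,t_k$ with the relations $g_ig_j=g_jg_i$ for $|i-j|>1$; $g_ig_jg_i=g_jg_ig_j$ for $|i-j|=1$; $t_it_j=t_jt_i$; $t_jg_i=g_it_{s_i(j)}$, where $s_i$ is the transposition $(i,i+1)$; $t_i^d=1$; and $g_i^2=1+(u-1)e_i+(u-1)e_ig_i$, where $e_i:=\frac1d\sum_{s=0}^{d-1}t_i^st_{i+1}^{d-s}$. There is a unique ${\mathbb C}$-linear map ${\rm tr}$ from the inductive limit of the algebras ${\rm Y}_{d,k}(u)$ (along the homomorphisms ${\rm Y}_{d,k}(u)\to{\rm Y}_{d,k+1}(u)$ with $g_i\mapsto g_i$, $t_j\mapsto t_j$) to ${\mathbb C}$ (the Juyumaya trace with parameters $z,x_1,\dots,x_{d-1}$)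 such that ${\rm tr}(1)=1$ and, for all $k\ge1$ and $a,b\in{\rm Y}_{d,k}(u)$: ${\rm tr}(ab)={\rm tr}(ba)$; ${\rm tr}(a\,g_k)=z\,{\rm tr}(a)$; and ${\rm tr}(a\,t_{k+1}^m)=x_m\,{\rm tr}(a)$ for $1\le m\le d-1$. Let ${\rm YTL}_{d,n}(u)$ be the quotient of ${\rm Y}_{d,n}(u)$ by the two-sided ideal generated by the elements $g_ig_{i+1}g_i+g_{i+1}g_i+g_ig_{i+1}+g_i+g_{i+1}+1$, $1\le i\le n-2$. **Theorem.** The trace ${\rm tr}$ exists and is unique, and it passes to the quotient, i.e. its restriction to ${\rm Y}_{d,n}(u)$ factors through the projection ${\rm Y}_{d,n}(u)\to{\rm YTL}_{d,n}(u)$, if and only if $(x_1,\dots,x_{d-1})$ solves the E-system $$E^{(m)}=x_mE^{(0)}\quad(1\le m\le d-1),\qquad E^{(m)}:=\frac1d\sum_{s=0}^{d-1}x_{m+s}x_{d-s},$$ and one of the following two cases holds: (i) there is $m_1$ with $0\le m_1\le d-1$ such that $x_\ell=\exp(\ell m_1)$ for $0\le\ell\le d-1$ (so that the $x_\ell$ are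 $d$-th roots of unity), and either $u\ne-1$ and $z=-\frac1{u+1}$, or $z=-1$; (ii) there are $m_1\neq m_2$ with $0\le m_1,m_2\le d-1$ such that $x_\ell=\frac12\left(\exp(\ell m_1)+\exp(\ell m_2)\right)$ for $0\le\ell\le d-1$, and $z=-\frac12$. -/

import Mathlib

open scoped BigOperators

noncomputable section

namespace YokonumaHecke

/-- Generators of the Yokonuma-Hecke algebra on `n` strands. Strands are numbered `0, …, n - 1`:
`g i` is the braiding generator exchanging the strands `i` and `i + 1`, and `t j` is the framing
generator of the strand `j`. -/
inductive Gen (n : ℕ) : Type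
  | g (i : ℕ) (hi : i + 1 < n) : Gen n
  | t (j : Fin n) : Gen n

/-- The braiding generator `g_i` in the free algebra. -/
def freeG {n : ℕ} (i : ℕ) (hi : i + 1 < n) : FreeAlgebra ℂ (Gen n) :=
  FreeAlgebra.ι ℂ (Gen.g i hi)

/-- The framing generator `t_j` in the free algebra. -/
def freeT {n : ℕ} (j : Fin n) : FreeAlgebra ℂ (Gen n) :=
  FreeAlgebra.ι ℂ (Gen.t j)

/-- `e_i = (1/d) ∑_{s=0}^{d-1} t_i^s t_{i+1}^{d-s}` in the free algebra. -/
def freeE (d : ℕ) {n : ℕ} (i : ℕ) (hi : i + 1 < n) : FreeAlgebra ℂ (Gen n) :=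
  (1 / (d : ℂ)) • ∑ s ∈ Finset.range d,
    freeT (⟨i, Nat.lt_of_succ_lt hi⟩ : Fin n) ^ s * freeT (⟨i + 1, hi⟩ : Fin n) ^ (d - s)

/-- The defining relations of the Yokonuma-Hecke algebra. -/
inductive Rel (d n : ℕ) (u : ℂ) : FreeAlgebra ℂ (Gen n) → FreeAlgebra ℂ (Gen n) → Prop
  | far (i j : ℕ) (hi : i + 1 < n) (hj : j + 1 < n) (hij : i + 1 < j) :
      Rel d n u (freeG i hi * freeG j hj) (freeG j hj * freeG i hi)
  | braid (i : ℕ) (hi : i + 1 < n) (hi' : i + 1 + 1 < n) :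
      Rel d n u (freeG i hi * freeG (i + 1) hi' * freeG i hi)
        (freeG (i + 1) hi' * freeG i hi * freeG (i + 1) hi')
  | framing_comm (j k : Fin n) :
      Rel d n u (freeT j * freeT k) (freeT k * freeT j)
  | mixed (i : ℕ) (hi : i + 1 < n) (j : Fin n) :
      Rel d n u (freeT j * freeG i hi)
        (freeG i hi * freeT (Equiv.swap (⟨i, Nat.lt_of_succ_lt hi⟩ : Fin n) ⟨i + 1, hi⟩ j))
  | modular (j : Fin n) :
      Rel d n u (freeT j ^ d) 1
  | quadratic (i : ℕ) (hi : i + 1 < n) :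
      Rel d n u (freeG i hi ^ 2)
        (1 + (u - 1) • freeE d i hi + (u - 1) • (freeE d i hi * freeG i hi))

/-- The Yokonuma-Hecke algebra `Y_{d,n}(u)`. -/
abbrev Y (d n : ℕ) (u : ℂ) : Type := RingQuot (Rel d n u)

/-- The generator `g_i` of `Y_{d,n}(u)`. -/
def g (d : ℕ) {n : ℕ} (u : ℂ) (i : ℕ) (hi : i + 1 < n) : Y d n u :=
  RingQuot.mkAlgHom ℂ (Rel d n u) (freeG i hi)

/-- The generator `t_j` of `Y_{d,n}(u)`. -/
def t (d : ℕ) {n : ℕ} (u : ℂ) (j : Fin n) : Y d n u :=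
  RingQuot.mkAlgHom ℂ (Rel d n u) (freeT j)

/-- The images in `Y_{d,n+1}(u)` of the generators on the first `n` strands. -/
def genSucc (d n : ℕ) (u : ℂ) : Gen n → Y d (n + 1) u
  | Gen.g i hi => g d u i (Nat.lt_succ_of_lt hi)
  | Gen.t j => t d u j.castSucc

theorem lift_genSucc_freeG (d n : ℕ) (u : ℂ) (i : ℕ) (hi : i + 1 < n) :
    FreeAlgebra.lift ℂ (genSucc d n u) (freeG i hi) =
      RingQuot.mkAlgHom ℂ (Rel d (n + 1) u) (freeG i (Nat.lt_succ_of_lt hi)) := by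
  simp [freeG, genSucc, g]

theorem lift_genSucc_freeT (d n : ℕ) (u : ℂ) (j : Fin n) :
    FreeAlgebra.lift ℂ (genSucc d n u) (freeT j) =
      RingQuot.mkAlgHom ℂ (Rel d (n + 1) u) (freeT j.castSucc) := by
  simp [freeT, genSucc, t]

theorem lift_genSucc_freeE (d n : ℕ) (u : ℂ) (i : ℕ) (hi : i + 1 < n) :
    FreeAlgebra.lift ℂ (genSucc d n u) (freeE d i hi) =
      RingQuot.mkAlgHom ℂ (Rel d (n + 1) u) (freeE d i (Nat.lt_succ_of_lt hi)) := by
  simp [freeE, lift_genSucc_freeT]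

theorem castSucc_swap {n : ℕ} (a b j : Fin n) :
    (Equiv.swap a b j).castSucc = Equiv.swap a.castSucc b.castSucc j.castSucc := by
  simp only [Equiv.swap_apply_def, Fin.castSucc_inj]
  split_ifs <;> rfl

theorem lift_genSucc_rel (d n : ℕ) (u : ℂ) ⦃a b : FreeAlgebra ℂ (Gen n)⦄ (h : Rel d n u a b) :
    FreeAlgebra.lift ℂ (genSucc d n u) a = FreeAlgebra.lift ℂ (genSucc d n u) b := by
  cases h with
  | far i j hi hj hij =>
    simp only [map_mul, lift_genSucc_freeG]
    simp only [← map_mul]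
    exact RingQuot.mkAlgHom_rel ℂ (Rel.far i j _ _ hij)
  | braid i hi hi' =>
    simp only [map_mul, lift_genSucc_freeG]
    simp only [← map_mul]
    exact RingQuot.mkAlgHom_rel ℂ (Rel.braid i _ _)
  | framing_comm j k =>
    simp only [map_mul, lift_genSucc_freeT]
    simp only [← map_mul]
    exact RingQuot.mkAlgHom_rel ℂ (Rel.framing_comm _ _)
  | mixed i hi j =>
    simp only [map_mul, lift_genSucc_freeG, lift_genSucc_freeT, castSucc_swap]
    simp only [← map_mul]
    exact RingQuot.mkAlgHom_rel ℂ (Rel.mixed i (Nat.lt_succ_of_lt hi) j.castSucc)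
  | modular j =>
    simp only [map_pow, map_one, lift_genSucc_freeT]
    rw [← map_pow, ← map_one (RingQuot.mkAlgHom ℂ (Rel d (n + 1) u))]
    exact RingQuot.mkAlgHom_rel ℂ (Rel.modular _)
  | quadratic i hi =>
    simp only [map_add, map_mul, map_pow, map_one, map_smul, lift_genSucc_freeG,
      lift_genSucc_freeE]
    simpa only [map_add, map_mul, map_pow, map_one, map_smul] using
      RingQuot.mkAlgHom_rel ℂ (Rel.quadratic (d := d) (u := u) i (Nat.lt_succ_of_lt hi))

/-- The natural homomorphism `Y_{d,n}(u) → Y_{d,n+1}(u)`, sending each generator to the generator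
of the same name; the inductive limit of the algebras is taken along these maps. -/
def incl (d n : ℕ) (u : ℂ) : Y d n u →ₐ[ℂ] Y d (n + 1) u :=
  RingQuot.liftAlgHom ℂ ⟨FreeAlgebra.lift ℂ (genSucc d n u), lift_genSucc_rel d n u⟩

/-- A linear map on the inductive limit of the algebras `Y_{d,n}(u)`, given as a family of linear
maps compatible with the homomorphisms `incl`, is the Juyumaya trace with parameters `z` and
`x_1, …, x_{d-1}` if it satisfies `tr(1) = 1`, `tr(ab) = tr(ba)`, the Markov property
`tr(a g_n) = z tr(a)` and `tr(a t_{n+1}^m) = x_m tr(a)` for `1 ≤ m ≤ d - 1` (`a` on `n` strands).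
The family starts at `n = 0`, where the algebra is `ℂ`; the Markov property concerns at least one
strand. -/
structure IsJuyumayaTrace (d : ℕ) (u z : ℂ) (x : ZMod d → ℂ)
    (tr : (n : ℕ) → Y d n u →ₗ[ℂ] ℂ) : Prop where
  compat : ∀ (n : ℕ) (a : Y d n u), tr (n + 1) (incl d n u a) = tr n a
  map_one : ∀ n : ℕ, tr n 1 = 1
  map_mul_comm : ∀ (n : ℕ) (a b : Y d n u), tr n (a * b) = tr n (b * a)
  markov : ∀ (n : ℕ) (a : Y d (n + 1) u),
    tr (n + 2) (incl d (n + 1) u a * g d u n (Nat.lt_succ_self (n + 1))) = z * tr (n + 1) a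
  framing : ∀ (n : ℕ) (a : Y d n u) (m : ℕ), 1 ≤ m → m ≤ d - 1 →
    tr (n + 1) (incl d n u a * t d u (Fin.last n) ^ m) = x (m : ZMod d) * tr n a

/-- `g_{i,i+1} = g_i g_{i+1} g_i + g_{i+1} g_i + g_i g_{i+1} + g_i + g_{i+1} + 1`. -/
def steinberg (d : ℕ) {n : ℕ} (u : ℂ) (i : ℕ) (hi : i + 2 < n) : Y d n u :=
  let a : Y d n u := g d u i (Nat.lt_of_succ_lt hi)
  let b : Y d n u := g d u (i + 1) hi
  a * b * a + b * a + a * b + a + b + 1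

/-- The two-sided ideal of `Y_{d,n}(u)` generated by all the elements `g_{i,i+1}`. -/
def ytlIdeal (d n : ℕ) (u : ℂ) : TwoSidedIdeal (Y d n u) :=
  TwoSidedIdeal.span {a | ∃ (i : ℕ) (hi : i + 2 < n), a = steinberg d u i hi}

/-- The Yokonuma-Temperley-Lieb algebra `YTL_{d,n}(u)`. -/
abbrev YTL (d n : ℕ) (u : ℂ) : Type := (ytlIdeal d n u).ringCon.Quotient

/-- The canonical projection `Y_{d,n}(u) → YTL_{d,n}(u)`. -/
def toYTL (d n : ℕ) (u : ℂ) : Y d n u →ₐ[ℂ] YTL d n u := RingCon.mkₐ ℂ (ytlIdeal d n u).ringCon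

/-- A linear form on `Y_{d,n}(u)` passes to the quotient `YTL_{d,n}(u)` if it factors through the
canonical projection as a linear form on `YTL_{d,n}(u)`. -/
def PassesToYTL (d n : ℕ) (u : ℂ) (τ : Y d n u →ₗ[ℂ] ℂ) : Prop :=
  ∃ φ : YTL d n u →ₗ[ℂ] ℂ, φ ∘ₗ (toYTL d n u).toLinearMap = τ

/-- `E^{(m)} = (1/d) ∑_{s} x_{m+s} x_{d-s}`, with the indices modulo `d`. -/
def ESum (d : ℕ) [NeZero d] (x : ZMod d → ℂ) (m : ZMod d) : ℂ :=
  (1 / (d : ℂ)) * ∑ s : ZMod d, x (m + s) * x (-s)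

/-- The E-system `E^{(m)} = x_m E` for `1 ≤ m ≤ d - 1`, where `E = E^{(0)}`. -/
def IsESolution (d : ℕ) [NeZero d] (x : ZMod d → ℂ) : Prop :=
  ∀ m : ZMod d, m ≠ 0 → ESum d x m = x m * ESum d x 0

/-- `exp(k) = e^{2πik/d}`. -/
def dexp (d k : ℕ) : ℂ := Complex.exp (2 * Real.pi * Complex.I * k / d)

end YokonumaHecke

end

/-! Existence. The trace is built one strand at a time. For each `d`-th root of unity `ζ`, the
algebra on `n + 1` strands acts on the module with basis the cosets `v_k = g_k ⋯ g_{n-1}`, `0 ≤ k ≤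
n`, over the algebra on `n` strands, with `t_n` acting on `v_n` by `ζ` (`Relations.induced`).
Applying `y` to `v_n`, one reads off the coefficient of `v_n`, weighted by a Fourier coefficient of
`x`, and `z` times the image of the other coefficients under an equivariant projection which deletes
`g_{n-1}`. Summing over `ζ` gives the Markov and framing rules in bimodule form (`IsMarkov`).
Uniqueness follows because the elements `a t_n^m b` and `a g_{n-1} b` span (`bimoduleSpan_eq_top`).

That the functional is a trace is an induction over two consecutive levels (`IsMarkov.comm`). The
only hard commutation is with the last braiding generator, and it amounts to the symmetry of `(a, b)
↦ tr(g_n a g_n b)` (`IsMarkov.G_comm`), checked on the spanning elements.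

Passing to the quotient. A trace factors if and only if it kills all `y g_{i,i+1}`. For `u ≠ 0` the
braiding generators are invertible and conjugate the elements `g_{i,i+1}` into each other, and the
Markov rules reduce everything to three strands. There `g_0` and `g_1` are absorbed by `g_{0,1}` up
to framing elements, so only the scalars `tr(t_0^a t_1^b t_2^c g_{0,1})` have to vanish
(`IsMarkov.passesToYTL_iff`).

Solving. Comparing the equations for `(a, b, 0)` and `(a + b, 0, 0)` gives `(1 + 2z)(x_{a+b} - x_a
x_b) = 0`. If `z ≠ -1/2`, then `x` is a character of `ℤ/d`. If `z = -1/2`, the equations make `2x` a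
two-dimensional pseudocharacter, hence a sum of two characters. For a single character the remaining
equation is `(1 + z)(1 + (u + 1)z) = 0`. Characters and averages of two distinct characters solve
the E-system automatically. -/

noncomputable section

namespace YokonumaHecke

/-! ### Powers with exponents in `ZMod d` and the averaging elements -/

section ModPow

variable {d : ℕ}

/-- The power `a ^ s` for an exponent modulo `d`; meaningful when `a ^ d = 1`. -/
def modPow {M : Type*} [Monoid M] (a : M) (s : ZMod d) : M := a ^ s.val

variable {M : Type*} [Monoid M] {a b : M}

theorem modPow_natCast (ha : a ^ d = 1) (m : ℕ) : modPow a (m : ZMod d) = a ^ m := by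
  rw [modPow, ZMod.val_natCast, ← pow_eq_pow_mod m ha]

theorem modPow_zero : modPow a (0 : ZMod d) = 1 := by simp [modPow]

theorem modPow_one (ha : a ^ d = 1) : modPow a (1 : ZMod d) = a := by
  simpa using modPow_natCast ha 1

theorem modPow_add [NeZero d] (ha : a ^ d = 1) (s r : ZMod d) :
    modPow a (s + r) = modPow a s * modPow a r := by
  rw [modPow, ZMod.val_add, ← pow_eq_pow_mod _ ha, pow_add]; rfl

theorem modPow_mul_neg [NeZero d] (ha : a ^ d = 1) (s : ZMod d) : modPow a s * modPow a (-s) = 1 := by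
  rw [← modPow_add ha, add_neg_cancel, modPow_zero]

theorem commute_modPow_left (h : Commute a b) (s : ZMod d) : Commute (modPow a s) b :=
  h.pow_left _

theorem commute_modPow_right (h : Commute a b) (s : ZMod d) : Commute a (modPow b s) :=
  h.pow_right _

theorem map_modPow {N F : Type*} [Monoid N] [FunLike F M N] [MonoidHomClass F M N] (φ : F)
    (a : M) (s : ZMod d) : φ (modPow a s) = modPow (φ a) s := map_pow _ _ _

end ModPow

section Avg

variable {d : ℕ} [NeZero d] {A : Type*} [Ring A] [Algebra ℂ A]

/-- The element `(1/d) ∑ a^s b^{-s}`. -/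
def avg (d : ℕ) [NeZero d] {A : Type*} [Ring A] [Algebra ℂ A] (a b : A) : A :=
  (1 / (d : ℂ)) • ∑ s : ZMod d, modPow a s * modPow b (-s)

theorem avg_eq_sum_range {a b : A} (hb : b ^ d = 1) :
    (1 / (d : ℂ)) • ∑ s ∈ Finset.range d, a ^ s * b ^ (d - s) = avg d a b := by
  rw [avg]
  congr 1
  refine Finset.sum_bij' (fun s _ => (s : ZMod d)) (fun s _ => s.val) (by simp)
    (fun s _ => by simpa using ZMod.val_lt s) (fun s hs => ?_) (by simp) (fun s hs => ?_)
  · exact ZMod.val_cast_of_lt (Finset.mem_range.1 hs)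
  · have hs := Finset.mem_range.1 hs
    -- At `s = 0` the natural exponent is `d` rather than `0`; the two powers agree because `b ^ d =
    -- 1`.
    have : (-(s : ZMod d)) = ((d - s : ℕ) : ZMod d) := by
      rw [Nat.cast_sub hs.le]; simp
    rw [this, modPow_natCast hb, modPow, ZMod.val_cast_of_lt hs]

theorem avg_comm {a b : A} (h : Commute a b) : avg d a b = avg d b a := by
  rw [avg, avg]
  congr 1
  rw [← Equiv.sum_comp (Equiv.neg (ZMod d))]
  refine Finset.sum_congr rfl fun s _ => ?_
  simp only [Equiv.neg_apply, neg_neg]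
  exact (h.pow_pow _ _).eq

/-- Shifting the summation index by `m` trades the factor `a^m` for `b^m`: the average projects onto
the part where `a` and `b` act alike. -/
theorem modPow_mul_avg {a b : A} (ha : a ^ d = 1) (hb : b ^ d = 1) (h : Commute a b) (m : ZMod d) :
    modPow a m * avg d a b = modPow b m * avg d a b := by
  rw [avg, mul_smul_comm, mul_smul_comm, Finset.mul_sum, Finset.mul_sum]
  congr 1
  rw [← Equiv.sum_comp (Equiv.addRight m) (fun s => modPow b m * (modPow a s * modPow b (-s)))]
  refine Finset.sum_congr rfl fun s _ => ?_
  rw [Equiv.coe_addRight, ← mul_assoc, ← modPow_add ha, ← mul_assoc,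
    (commute_modPow_right (commute_modPow_left h.symm m) (s + m)).eq, mul_assoc, ← modPow_add hb]
  congr 2
  · ring
  · ring

theorem mul_avg {a b : A} (ha : a ^ d = 1) (hb : b ^ d = 1) (h : Commute a b) :
    a * avg d a b = b * avg d a b := by
  simpa [modPow_one ha, modPow_one hb] using modPow_mul_avg ha hb h (1 : ZMod d)

theorem avg_self {a : A} (ha : a ^ d = 1) : avg d a a = 1 := by
  have hd : (d : ℂ) ≠ 0 := Nat.cast_ne_zero.2 (NeZero.ne d)
  simp only [avg, modPow_mul_neg ha, Finset.sum_const, Finset.card_univ, ZMod.card]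
  rw [← Nat.cast_smul_eq_nsmul ℂ, smul_smul, one_div, inv_mul_cancel₀ hd, one_smul]

theorem commute_avg_right {a b c : A} (ha : Commute c a) (hb : Commute c b) :
    Commute c (avg d a b) :=
  (Commute.sum_right _ _ _ fun s _ =>
    (commute_modPow_right ha s).mul_right (commute_modPow_right hb (-s))).smul_right _

/-- On a vector where `b` and `c` agree, `avg a b` may be replaced by `avg a c`. -/
theorem avg_mul_congr {a b c y : A} (hb : b * y = c * y) (hbc : Commute b c) :
    avg d a b * y = avg d a c * y := by
  have : ∀ m : ℕ, b ^ m * y = c ^ m * y := by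
    intro m
    induction m with
    | zero => simp
    | succ m ih =>
      rw [pow_succ', mul_assoc, ih, ← mul_assoc, (hbc.pow_right m).eq, mul_assoc, hb, ← mul_assoc,
        ← pow_succ]
  simp only [avg, smul_mul_assoc, Finset.sum_mul, mul_assoc]
  congr 1
  exact Finset.sum_congr rfl fun s _ => by rw [modPow, modPow, modPow, this]

/-- On the range of the average `b` may be replaced by `a`, and `avg d a a = 1`. -/
theorem avg_mul_avg {a b : A} (ha : a ^ d = 1) (hb : b ^ d = 1) (h : Commute a b) :
    avg d a b * avg d a b = avg d a b := by
  rw [avg_mul_congr (mul_avg ha hb h).symm h.symm, avg_self ha, one_mul]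

end Avg

/-! ### The relations for sequences of elements of an algebra -/

/-- The defining relations of `Y_{d,n}(u)`, for two sequences of elements of an algebra. -/
structure Relations (d n : ℕ) [NeZero d] (u : ℂ) {A : Type*} [Ring A] [Algebra ℂ A]
    (G T : ℕ → A) : Prop where
  far : ∀ i j, j + 1 < n → i + 1 < j → G i * G j = G j * G i
  braid : ∀ i, i + 2 < n → G i * G (i + 1) * G i = G (i + 1) * G i * G (i + 1)
  comm : ∀ j k, j < n → k < n → T j * T k = T k * T j
  left : ∀ i, i + 1 < n → T i * G i = G i * T (i + 1)
  right : ∀ i, i + 1 < n → T (i + 1) * G i = G i * T i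
  other : ∀ i j, i + 1 < n → j < n → j ≠ i → j ≠ i + 1 → T j * G i = G i * T j
  modular : ∀ j, j < n → T j ^ d = 1
  quadratic : ∀ i, i + 1 < n → G i * G i =
    1 + (u - 1) • avg d (T i) (T (i + 1)) + (u - 1) • (avg d (T i) (T (i + 1)) * G i)

/-- The braiding generators of `Y_{d,n}(u)` as a sequence, extended by `0`. -/
def G (d n : ℕ) (u : ℂ) (i : ℕ) : Y d n u := if h : i + 1 < n then g d u i h else 0

/-- The framing generators of `Y_{d,n}(u)` as a sequence, extended by `1`. -/
def T (d n : ℕ) (u : ℂ) (j : ℕ) : Y d n u := if h : j < n then t d u ⟨j, h⟩ else 1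

theorem G_of_lt {d n : ℕ} {u : ℂ} {i : ℕ} (h : i + 1 < n) : G d n u i = g d u i h := dif_pos h

theorem T_of_lt {d n : ℕ} {u : ℂ} {j : ℕ} (h : j < n) : T d n u j = t d u ⟨j, h⟩ := dif_pos h

section Lift

variable {d n : ℕ} [NeZero d] {u : ℂ} {A : Type*} [Ring A] [Algebra ℂ A] {γ τ : ℕ → A}

/-- The images of the generators under the homomorphism attached to two sequences. -/
def genSeq (n : ℕ) {A : Type*} (γ τ : ℕ → A) : Gen n → A
  | Gen.g i _ => γ i
  | Gen.t j => τ j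

theorem Relations.lift_rel (h : Relations d n u γ τ) ⦃a b : FreeAlgebra ℂ (Gen n)⦄
    (hab : Rel d n u a b) :
    FreeAlgebra.lift ℂ (genSeq n γ τ) a = FreeAlgebra.lift ℂ (genSeq n γ τ) b := by
  have hG : ∀ i hi, FreeAlgebra.lift ℂ (genSeq n γ τ) (freeG i hi) = γ i := fun i hi => by
    simp [freeG, genSeq]
  have hT : ∀ j, FreeAlgebra.lift ℂ (genSeq n γ τ) (freeT j) = τ j := fun j => by
    simp [freeT, genSeq]
  have hE : ∀ i hi, FreeAlgebra.lift ℂ (genSeq n γ τ) (freeE d i hi) = avg d (τ i) (τ (i + 1)) :=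
    fun i hi => by
      rw [← avg_eq_sum_range (h.modular _ hi)]
      simp [freeE, hT]
  cases hab with
  | far i j hi hj hij => simpa only [map_mul, hG] using h.far i j hj hij
  | braid i hi hi' => simpa only [map_mul, hG] using h.braid i hi'
  | framing_comm j k => simpa only [map_mul, hT] using h.comm j k j.2 k.2
  | mixed i hi j =>
    simp only [map_mul, hG, hT]
    by_cases h1 : (j : ℕ) = i
    · obtain rfl : j = ⟨i, Nat.lt_of_succ_lt hi⟩ := Fin.ext h1
      simpa using h.left i hi
    by_cases h2 : (j : ℕ) = i + 1
    · obtain rfl : j = ⟨i + 1, hi⟩ := Fin.ext h2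
      simpa using h.right i hi
    rw [Equiv.swap_apply_of_ne_of_ne (fun h => h1 (congrArg Fin.val h))
      (fun h => h2 (congrArg Fin.val h))]
    exact h.other i j hi j.2 h1 h2
  | modular j => simpa only [map_pow, map_one, hT] using h.modular j j.2
  | quadratic i hi =>
    simp only [map_add, map_mul, map_one, map_smul, hG, hE, pow_two]
    exact h.quadratic i hi

/-- The homomorphism from `Y_{d,n}(u)` attached to two sequences satisfying the relations. -/
def Relations.lift (h : Relations d n u γ τ) : Y d n u →ₐ[ℂ] A :=
  RingQuot.liftAlgHom ℂ ⟨FreeAlgebra.lift ℂ (genSeq n γ τ), h.lift_rel⟩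

theorem Relations.lift_G (h : Relations d n u γ τ) {i : ℕ} (hi : i + 1 < n) :
    h.lift (G d n u i) = γ i := by
  simp [G_of_lt hi, g, Relations.lift, freeG, genSeq]

theorem Relations.lift_T (h : Relations d n u γ τ) {j : ℕ} (hj : j < n) :
    h.lift (T d n u j) = τ j := by
  simp [T_of_lt hj, t, Relations.lift, freeT, genSeq]

end Lift

section Basic

variable {d n : ℕ} [NeZero d] {u : ℂ}

theorem relations_Y : Relations d n u (G d n u) (T d n u) := by
  have hmod : ∀ j, j < n → T d n u j ^ d = 1 := fun j hj => by
    rw [T_of_lt hj, t, ← map_pow, ← map_one (RingQuot.mkAlgHom ℂ (Rel d n u))]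
    exact RingQuot.mkAlgHom_rel ℂ (Rel.modular _)
  have hmix : ∀ i (hi : i + 1 < n) (j : Fin n), t d u j * g d u i hi = g d u i hi *
      t d u (Equiv.swap (⟨i, Nat.lt_of_succ_lt hi⟩ : Fin n) ⟨i + 1, hi⟩ j) := fun i hi j => by
    simp only [g, t, ← map_mul]
    exact RingQuot.mkAlgHom_rel ℂ (Rel.mixed i hi j)
  refine ⟨fun i j hj hij => ?_, fun i hi => ?_, fun j k hj hk => ?_, fun i hi => ?_,
    fun i hi => ?_, fun i j hi hj h1 h2 => ?_, hmod, fun i hi => ?_⟩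
  · rw [G_of_lt hj, G_of_lt (by omega)]
    simp only [g, ← map_mul]
    exact RingQuot.mkAlgHom_rel ℂ (Rel.far i j _ _ hij)
  · rw [G_of_lt (show i + 1 + 1 < n from hi), G_of_lt (by omega)]
    simp only [g, ← map_mul]
    exact RingQuot.mkAlgHom_rel ℂ (Rel.braid i _ _)
  · rw [T_of_lt hj, T_of_lt hk]
    simp only [t, ← map_mul]
    exact RingQuot.mkAlgHom_rel ℂ (Rel.framing_comm _ _)
  · rw [G_of_lt hi, T_of_lt hi, T_of_lt (by omega), hmix, Equiv.swap_apply_left]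
  · rw [G_of_lt hi, T_of_lt hi, T_of_lt (by omega), hmix, Equiv.swap_apply_right]
  · rw [G_of_lt hi, T_of_lt hj, hmix, Equiv.swap_apply_of_ne_of_ne
      (fun h => h1 (congrArg Fin.val h)) (fun h => h2 (congrArg Fin.val h))]
  · have hE : RingQuot.mkAlgHom ℂ (Rel d n u) (freeE d i hi) =
        avg d (T d n u i) (T d n u (i + 1)) := by
      rw [← avg_eq_sum_range (hmod _ hi), T_of_lt hi, T_of_lt (by omega)]
      simp [freeE, t]
    have := RingQuot.mkAlgHom_rel ℂ (Rel.quadratic (d := d) (u := u) i hi)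
    simp only [map_add, map_mul, map_one, map_smul, hE, pow_two] at this
    rw [G_of_lt hi]
    exact this

omit [NeZero d] in
theorem mem_subalgebra {n : ℕ} (S : Subalgebra ℂ (Y d n u)) (hG : ∀ i, i + 1 < n → G d n u i ∈ S)
    (hT : ∀ j, j < n → T d n u j ∈ S) (y : Y d n u) : y ∈ S := by
  obtain ⟨y, rfl⟩ := RingQuot.mkAlgHom_surjective ℂ (Rel d n u) y
  induction y using FreeAlgebra.induction with
  | grade0 r => exact (AlgHom.commutes (RingQuot.mkAlgHom ℂ (Rel d n u)) r) ▸ S.algebraMap_mem r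
  | grade1 x =>
    cases x with
    | g i hi =>
      have := hG i hi
      rwa [G_of_lt hi] at this
    | t j =>
      have := hT j j.2
      rwa [T_of_lt j.2] at this
  | mul a b ha hb => rw [map_mul]; exact S.mul_mem ha hb
  | add a b ha hb => rw [map_add]; exact S.add_mem ha hb

omit [NeZero d] in
/-- A property of elements of `Y_{d,n}(u)` that is linear holds everywhere if it holds for `1` and
is preserved by left multiplication by the generators. -/
theorem mem_of_left_mul {n : ℕ} (S : Submodule ℂ (Y d n u)) (h1 : 1 ∈ S)
    (hG : ∀ i, i + 1 < n → ∀ y ∈ S, G d n u i * y ∈ S)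
    (hT : ∀ j, j < n → ∀ y ∈ S, T d n u j * y ∈ S) (y : Y d n u) : y ∈ S := by
  let U : Subalgebra ℂ (Y d n u) :=
    { carrier := {a | ∀ y ∈ S, a * y ∈ S}
      mul_mem' := fun {a b} ha hb y hy => by rw [mul_assoc]; exact ha _ (hb _ hy)
      add_mem' := fun {a b} ha hb y hy => by rw [add_mul]; exact S.add_mem (ha _ hy) (hb _ hy)
      algebraMap_mem' := fun r y hy => by
        rw [← Algebra.smul_def]; exact S.smul_mem _ hy }
  have := mem_subalgebra U hG hT y 1 h1
  rwa [mul_one] at this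

omit [NeZero d] in
theorem incl_G {i : ℕ} (hi : i + 1 < n) : incl d n u (G d n u i) = G d (n + 1) u i := by
  rw [G_of_lt hi, G_of_lt (Nat.lt_succ_of_lt hi)]
  simp [incl, g, freeG, genSucc]

omit [NeZero d] in
theorem incl_T {j : ℕ} (hj : j < n) : incl d n u (T d n u j) = T d (n + 1) u j := by
  rw [T_of_lt hj, T_of_lt (Nat.lt_succ_of_lt hj)]
  simp [incl, t, freeT, genSucc]

theorem T_pow {j : ℕ} : T d n u j ^ d = 1 := by
  by_cases h : j < n
  · exact relations_Y.modular j h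
  · simp [T, h]

theorem T_comm (j k : ℕ) : Commute (T d n u j) (T d n u k) := by
  by_cases hj : j < n
  · by_cases hk : k < n
    · exact relations_Y.comm j k hj hk
    · simp [T, hk]
  · simp [T, hj]

omit [NeZero d] in
theorem incl_commute_of {c : Y d (n + 1) u} (hG : ∀ i, i + 1 < n → Commute c (G d (n + 1) u i))
    (hT : ∀ j, j < n → Commute c (T d (n + 1) u j)) (a : Y d n u) : Commute c (incl d n u a) := by
  let U : Subalgebra ℂ (Y d n u) := (Subalgebra.centralizer ℂ {c}).comap (incl d n u)
  have := mem_subalgebra U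
    (fun i hi => by
      simp only [U, Subalgebra.mem_comap, Subalgebra.mem_centralizer_iff, incl_G hi]
      simpa using (hG i hi).eq)
    (fun j hj => by
      simp only [U, Subalgebra.mem_comap, Subalgebra.mem_centralizer_iff, incl_T hj]
      simpa using (hT j hj).eq) a
  simp only [U, Subalgebra.mem_comap, Subalgebra.mem_centralizer_iff] at this
  exact this c rfl

theorem T_commute_incl (a : Y d n u) : Commute (T d (n + 1) u n) (incl d n u a) :=
  incl_commute_of (fun i hi => relations_Y.other i n (by omega) (by omega) (by omega) (by omega))
    (fun _ _ => T_comm _ _) a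

/-- The generator `g_n` moves only the strands `n` and `n + 1`, while `a` lives on `0, …, n - 1`. -/
theorem G_commute_incl_incl (a : Y d n u) :
    Commute (G d (n + 2) u n) (incl d (n + 1) u (incl d n u a)) := by
  let U : Subalgebra ℂ (Y d n u) := (Subalgebra.centralizer ℂ {G d (n + 2) u n}).comap
    ((incl d (n + 1) u).comp (incl d n u))
  have := mem_subalgebra U
    (fun i hi => by
      simp only [U, Subalgebra.mem_comap, Subalgebra.mem_centralizer_iff, AlgHom.comp_apply,
        incl_G hi, incl_G (show i + 1 < n + 1 by omega)]
      simpa using ((relations_Y (d := d) (n := n + 2) (u := u)).far i n (by omega) (by omega)).symm)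
    (fun j hj => by
      simp only [U, Subalgebra.mem_comap, Subalgebra.mem_centralizer_iff, AlgHom.comp_apply,
        incl_T hj, incl_T (show j < n + 1 by omega)]
      simpa using ((relations_Y (d := d) (n := n + 2) (u := u)).other n j (by omega) (by omega)
        (by omega) (by omega)).symm) a
  simp only [U, Subalgebra.mem_comap, Subalgebra.mem_centralizer_iff, AlgHom.comp_apply] at this
  exact this _ rfl

end Basic

/-! ### Spanning sets -/

section Span

variable {d n : ℕ} {u : ℂ}

/-- The span of the elements `a t_n^m b` and `a g_{n-1} b` with `a`, `b` on `n` strands. -/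
def bimoduleSpan (d n : ℕ) (u : ℂ) : Submodule ℂ (Y d (n + 1) u) :=
  Submodule.span ℂ ({y | ∃ (a b : Y d n u) (m : ZMod d),
      y = incl d n u a * modPow (T d (n + 1) u n) m * incl d n u b} ∪
    {y | ∃ (i : ℕ) (a b : Y d n u), i + 1 = n ∧
      y = incl d n u a * G d (n + 1) u i * incl d n u b})

theorem framing_mem (a b : Y d n u) (m : ZMod d) :
    incl d n u a * modPow (T d (n + 1) u n) m * incl d n u b ∈ bimoduleSpan d n u :=
  Submodule.subset_span (Or.inl ⟨a, b, m, rfl⟩)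

theorem braid_mem {i : ℕ} (hi : i + 1 = n) (a b : Y d n u) :
    incl d n u a * G d (n + 1) u i * incl d n u b ∈ bimoduleSpan d n u :=
  Submodule.subset_span (Or.inr ⟨i, a, b, hi, rfl⟩)

theorem bimoduleSpan_le {S : Submodule ℂ (Y d (n + 1) u)}
    (hT : ∀ (a b : Y d n u) (m : ZMod d),
      incl d n u a * modPow (T d (n + 1) u n) m * incl d n u b ∈ S)
    (hG : ∀ i, i + 1 = n → ∀ a b : Y d n u, incl d n u a * G d (n + 1) u i * incl d n u b ∈ S) :
    bimoduleSpan d n u ≤ S := by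
  rw [bimoduleSpan, Submodule.span_le]
  rintro y (⟨a, b, m, rfl⟩ | ⟨i, a, b, hi, rfl⟩)
  · exact hT a b m
  · exact hG i hi a b

theorem incl_mul_mem_bimoduleSpan (c : Y d n u) {y : Y d (n + 1) u} (hy : y ∈ bimoduleSpan d n u) :
    incl d n u c * y ∈ bimoduleSpan d n u := by
  have := bimoduleSpan_le (S := (bimoduleSpan d n u).comap (LinearMap.mulLeft ℂ (incl d n u c)))
    (fun a b m => by
      have := framing_mem (c * a) b m
      simpa only [Submodule.mem_comap, LinearMap.mulLeft_apply, map_mul, mul_assoc] using this)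
    (fun i hi a b => by
      have := braid_mem hi (c * a) b
      simpa only [Submodule.mem_comap, LinearMap.mulLeft_apply, map_mul, mul_assoc] using this) hy
  exact this

theorem mul_incl_mem_bimoduleSpan (c : Y d n u) {y : Y d (n + 1) u} (hy : y ∈ bimoduleSpan d n u) :
    y * incl d n u c ∈ bimoduleSpan d n u := by
  have := bimoduleSpan_le (S := (bimoduleSpan d n u).comap (LinearMap.mulRight ℂ (incl d n u c)))
    (fun a b m => by
      have := framing_mem a (b * c) m
      simpa only [Submodule.mem_comap, LinearMap.mulRight_apply, map_mul, mul_assoc] using this)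
    (fun i hi a b => by
      have := braid_mem hi a (b * c)
      simpa only [Submodule.mem_comap, LinearMap.mulRight_apply, map_mul, mul_assoc] using this) hy
  exact this

variable [NeZero d]

theorem G_mul_modPow_left {i : ℕ} (hi : i + 1 < n) (m : ZMod d) :
    G d n u i * modPow (T d n u i) m = modPow (T d n u (i + 1)) m * G d n u i :=
  SemiconjBy.pow_right (relations_Y.right i hi).symm _

theorem G_mul_modPow_right {i : ℕ} (hi : i + 1 < n) (m : ZMod d) :
    G d n u i * modPow (T d n u (i + 1)) m = modPow (T d n u i) m * G d n u i :=
  SemiconjBy.pow_right (relations_Y.left i hi).symm _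

omit [NeZero d] in
theorem incl_modPow {j : ℕ} (hj : j < n) (m : ZMod d) :
    incl d n u (modPow (T d n u j) m) = modPow (T d (n + 1) u j) m := by
  rw [map_modPow, incl_T hj]

theorem modPow_commute_incl (a : Y d n u) (m : ZMod d) :
    Commute (modPow (T d (n + 1) u n) m) (incl d n u a) :=
  commute_modPow_left (T_commute_incl a) m

/-- Passing `t_n` through `g_{n-1}` turns it into `t_{n-1}`, which is absorbed into the right-hand
factor on `n` strands. -/
theorem T_mul_mem_bimoduleSpan {y : Y d (n + 1) u} (hy : y ∈ bimoduleSpan d n u) :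
    T d (n + 1) u n * y ∈ bimoduleSpan d n u := by
  have := bimoduleSpan_le
    (S := (bimoduleSpan d n u).comap (LinearMap.mulLeft ℂ (T d (n + 1) u n)))
    (fun a b m => by
      have := framing_mem a b (1 + m)
      rw [modPow_add T_pow, modPow_one T_pow] at this
      simpa only [Submodule.mem_comap, LinearMap.mulLeft_apply, ← mul_assoc,
        (T_commute_incl a).eq] using this)
    (fun i hi a b => by
      subst hi
      have := braid_mem (d := d) (u := u) rfl a (T d (i + 1) u i * b)
      rw [map_mul, incl_T (by omega), ← mul_assoc, mul_assoc _ (G _ _ _ _),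
        ← relations_Y.right i (by omega), ← mul_assoc, ← (T_commute_incl a).eq] at this
      simpa only [Submodule.mem_comap, LinearMap.mulLeft_apply, ← mul_assoc] using this) hy
  exact this

omit [NeZero d] in
theorem framing_mem' (m : ZMod d) : modPow (T d (n + 1) u n) m ∈ bimoduleSpan d n u := by
  simpa using framing_mem (1 : Y d n u) 1 m

omit [NeZero d] in
theorem braid_mem' : G d (n + 2) u n ∈ bimoduleSpan d (n + 1) u := by
  simpa using braid_mem (d := d) (u := u) rfl (1 : Y d (n + 1) u) 1

theorem avg_mem {y : Y d (n + 2) u} (hy : y ∈ bimoduleSpan d (n + 1) u) :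
    avg d (T d (n + 2) u n) (T d (n + 2) u (n + 1)) * y ∈ bimoduleSpan d (n + 1) u := by
  rw [avg, smul_mul_assoc, Finset.sum_mul]
  refine Submodule.smul_mem _ _ (Submodule.sum_mem _ fun s _ => ?_)
  rw [mul_assoc, ← incl_modPow (by omega)]
  refine incl_mul_mem_bimoduleSpan _ ?_
  have : ∀ k : ℕ, T d (n + 2) u (n + 1) ^ k * y ∈ bimoduleSpan d (n + 1) u := by
    intro k
    induction k with
    | zero => simpa using hy
    | succ k ih => rw [pow_succ', mul_assoc]; exact T_mul_mem_bimoduleSpan ih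
  exact this _

theorem G_mul_G_mem : G d (n + 2) u n * G d (n + 2) u n ∈ bimoduleSpan d (n + 1) u := by
  rw [relations_Y.quadratic n (by omega)]
  have h1 : (1 : Y d (n + 2) u) ∈ bimoduleSpan d (n + 1) u := by
    simpa [modPow_zero] using framing_mem' (d := d) (u := u) (n := n + 1) 0
  refine Submodule.add_mem _ (Submodule.add_mem _ h1 (Submodule.smul_mem _ _ ?_))
    (Submodule.smul_mem _ _ (avg_mem braid_mem'))
  simpa using avg_mem h1

/-- The span contains `1`, so stability under left multiplication by the generators suffices. The
critical products are `g_n a g_n` with `a` on `n + 1` strands; the induction hypothesis brings `a`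
to one of the two standard forms. -/
theorem bimoduleSpan_eq_top (n : ℕ) (y : Y d (n + 1) u) : y ∈ bimoduleSpan d n u := by
  have h1 : ∀ n, (1 : Y d (n + 1) u) ∈ bimoduleSpan d n u := fun n => by
    simpa [modPow_zero] using framing_mem' (d := d) (u := u) (n := n) 0
  have hT : ∀ n, ∀ j, j < n + 1 → ∀ y ∈ bimoduleSpan d n u,
      T d (n + 1) u j * y ∈ bimoduleSpan d n u := fun n j hj y hy => by
    rcases Nat.lt_succ_iff_lt_or_eq.1 hj with hj | rfl
    · rw [← incl_T hj]; exact incl_mul_mem_bimoduleSpan _ hy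
    · exact T_mul_mem_bimoduleSpan hy
  induction n with
  | zero => exact mem_of_left_mul _ (h1 0) (fun i hi => by omega) (hT 0) y
  | succ n ih =>
    have hgg : ∀ a : Y d (n + 1) u, G d (n + 2) u n * incl d (n + 1) u a * G d (n + 2) u n ∈
        bimoduleSpan d (n + 1) u := fun a => by
      have := bimoduleSpan_le (d := d) (n := n) (u := u) (S := (bimoduleSpan d (n + 1) u).comap
        ((LinearMap.mulRight ℂ (G d (n + 2) u n)).comp
          ((LinearMap.mulLeft ℂ (G d (n + 2) u n)).comp (incl d (n + 1) u).toLinearMap)))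
        -- For `a t_n^m b` the outer factors commute with `g_n`, and `g_n t_n^m g_n = t_{n+1}^m
        -- g_n^2` is expanded by the quadratic relation.
        (fun a b m => by
          simp only [Submodule.mem_comap, LinearMap.comp_apply, LinearMap.mulLeft_apply,
            LinearMap.mulRight_apply, AlgHom.toLinearMap_apply, map_mul]
          rw [incl_modPow (by omega), mul_assoc (incl _ _ _ _), ← mul_assoc (G _ _ _ _),
            (G_commute_incl_incl a).eq, mul_assoc, mul_assoc, mul_assoc (modPow _ _), ← (G_commute_incl_incl b).eq]
          refine incl_mul_mem_bimoduleSpan _ ?_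
          rw [← mul_assoc, ← mul_assoc]
          refine mul_incl_mem_bimoduleSpan _ ?_
          rw [G_mul_modPow_left (by omega), mul_assoc]
          have : ∀ k : ℕ, ∀ y ∈ bimoduleSpan d (n + 1) u,
              T d (n + 2) u (n + 1) ^ k * y ∈ bimoduleSpan d (n + 1) u := by
            intro k y hy
            induction k with
            | zero => simpa using hy
            | succ k ih => rw [pow_succ', mul_assoc]; exact T_mul_mem_bimoduleSpan ih
          exact this _ _ G_mul_G_mem)
        -- For `a g_{n-1} b` the braid relation leaves a single occurrence of `g_n`.
        (fun i hi a b => by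
          subst hi
          simp only [Submodule.mem_comap, LinearMap.comp_apply, LinearMap.mulLeft_apply,
            LinearMap.mulRight_apply, AlgHom.toLinearMap_apply, map_mul]
          rw [incl_G (by omega), mul_assoc (incl _ _ _ _), ← mul_assoc (G _ _ _ _),
            (G_commute_incl_incl a).eq, mul_assoc, mul_assoc, mul_assoc (G d _ u i), ← (G_commute_incl_incl b).eq]
          refine incl_mul_mem_bimoduleSpan _ ?_
          rw [← mul_assoc, ← mul_assoc]
          refine mul_incl_mem_bimoduleSpan _ ?_
          rw [← relations_Y.braid i (by omega), ← incl_G (by omega)]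
          exact braid_mem rfl _ _) (ih a)
      exact this
    refine mem_of_left_mul _ (h1 _) (fun i hi y hy => ?_) (hT _) y
    by_cases hin : i < n
    · rw [← incl_G (by omega)]; exact incl_mul_mem_bimoduleSpan _ hy
    obtain rfl : i = n := by omega
    have := bimoduleSpan_le
      (S := (bimoduleSpan d (i + 1) u).comap (LinearMap.mulLeft ℂ (G d (i + 2) u i)))
      (fun a b m => by
        rw [Submodule.mem_comap, LinearMap.mulLeft_apply, ← (modPow_commute_incl a m).eq,
          ← mul_assoc, ← mul_assoc, G_mul_modPow_right (by omega), ← incl_modPow (by omega)]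
        have := braid_mem rfl (modPow (T d (i + 1) u i) m) (a * b)
        simpa only [map_mul, mul_assoc] using this)
      (fun j hj a b => by
        obtain rfl : j = i := by omega
        rw [Submodule.mem_comap, LinearMap.mulLeft_apply, ← mul_assoc, ← mul_assoc]
        exact mul_incl_mem_bimoduleSpan _ (hgg a)) hy
    exact this

/-- A linear property holds on `Y_{d,n+1}(u)` if it holds for the elements `a t_n^m b` and
`a g_{n-1} b` with `a`, `b` on `n` strands. -/
theorem mem_of_bimodule (S : Submodule ℂ (Y d (n + 1) u))
    (hT : ∀ (a b : Y d n u) (m : ZMod d),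
      incl d n u a * modPow (T d (n + 1) u n) m * incl d n u b ∈ S)
    (hG : ∀ i, i + 1 = n → ∀ a b : Y d n u, incl d n u a * G d (n + 1) u i * incl d n u b ∈ S)
    (y : Y d (n + 1) u) : y ∈ S :=
  bimoduleSpan_le hT hG (bimoduleSpan_eq_top n y)

/-- Two linear maps on `Y_{d,n+1}(u)` agree if they agree on the elements `a t_n^m b` and
`a g_{n-1} b` with `a`, `b` on `n` strands. -/
theorem eq_of_bimodule {V : Type*} [AddCommGroup V] [Module ℂ V] {φ ψ : Y d (n + 1) u →ₗ[ℂ] V}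
    (hT : ∀ (a b : Y d n u) (m : ZMod d),
      φ (incl d n u a * modPow (T d (n + 1) u n) m * incl d n u b) =
        ψ (incl d n u a * modPow (T d (n + 1) u n) m * incl d n u b))
    (hG : ∀ i, i + 1 = n → ∀ a b : Y d n u,
      φ (incl d n u a * G d (n + 1) u i * incl d n u b) =
        ψ (incl d n u a * G d (n + 1) u i * incl d n u b))
    (y : Y d (n + 1) u) : φ y = ψ y :=
  mem_of_bimodule (LinearMap.eqLocus φ ψ) hT hG y

omit [NeZero d] in
theorem eq_of_zero {V : Type*} [AddCommGroup V] [Module ℂ V] {φ ψ : Y d 0 u →ₗ[ℂ] V}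
    (h : φ 1 = ψ 1) (y : Y d 0 u) : φ y = ψ y :=
  mem_of_left_mul (LinearMap.eqLocus φ ψ) h (fun i hi => by omega) (fun i hi => by omega) y

end Span

/-! ### Induced representations

Given elements satisfying the relations on `n` strands and a `d`-th root of unity `ζ`, we construct
operators satisfying the relations on `n + 1` strands. The coordinate `k ≤ n` corresponds to the
coset of `g_k g_{k+1} ⋯ g_{n-1}`, with `t_n` acting by `ζ`; on the coordinates `k > n` the operators
are scalars. -/

section Induced

variable {d n : ℕ} [NeZero d] {u : ℂ} {A : Type*} [Ring A] [Algebra ℂ A] {γ τ : ℕ → A} {ζ : ℂ}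

/-- The multiple `(u-1) (1/d) ∑ τ_i^s ζ^{-s}` of the projection on the `ζ`-eigenspace of `τ_i`. -/
def eigenProj (d : ℕ) [NeZero d] {A : Type*} [Ring A] [Algebra ℂ A] (u : ℂ) (τ : ℕ → A) (ζ : ℂ)
    (i : ℕ) : A :=
  (u - 1) • avg d (τ i) (algebraMap ℂ A ζ)

/-- The operator of the framing generator `t_j` in the induced representation. -/
def framOp (n : ℕ) {A : Type*} [Ring A] [Algebra ℂ A] (τ : ℕ → A) (ζ : ℂ) (j : ℕ) :
    Module.End ℂ (ℕ → A) where
  -- This is the rule for moving `t_j` to the right through `g_k ⋯ g_{n-1}`: it becomes `t_n` (that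
  -- is, `ζ`) if `k = j`, `t_{j-1}` if `k < j`, and stays `t_j` if `k > j`.
  toFun f k := (if n < k then 1 else if k = j then algebraMap ℂ A ζ else
    if k < j then τ (j - 1) else τ j) * f k
  map_add' f h := by ext k; simp [mul_add]
  map_smul' c f := by ext k; simp

/-- The operator of the braiding generator `g_i` in the induced representation. -/
def braidOp (d n : ℕ) [NeZero d] (u : ℂ) {A : Type*} [Ring A] [Algebra ℂ A] (γ τ : ℕ → A) (ζ : ℂ)
    (i : ℕ) : Module.End ℂ (ℕ → A) where
  -- With `P = eigenProj` and `v_k = g_k ⋯ g_{n-1}`, one has `g_i v_{i+1} = v_i`, and the quadratic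
  -- relation gives `g_i v_i = v_{i+1} + P v_{i+1} + P v_i`. On the other cosets `g_i` slides
  -- through to `γ_{i-1}` or `γ_i`. Beyond `n` the scalar `u` solves the quadratic relation with all
  -- framings equal to `1`.
  toFun f k := if n < k then u • f k else
    if k = i then f (i + 1) + eigenProj d u τ ζ i * f i else
    if k = i + 1 then f i + eigenProj d u τ ζ i * f i else
    if k < i then γ (i - 1) * f k else γ i * f k
  map_add' f h := by ext k; simp only [Pi.add_apply]; split_ifs <;> simp [mul_add] <;> abel
  map_smul' c f := by
    ext k; simp only [Pi.smul_apply, RingHom.id_apply]; split_ifs <;> simp [smul_comm c]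

/-- The coefficient by which `framOp` acts on a coordinate. -/
theorem framOp_apply (j : ℕ) (f : ℕ → A) (k : ℕ) : framOp n τ ζ j f k =
    (if n < k then 1 else if k = j then algebraMap ℂ A ζ else
      if k < j then τ (j - 1) else τ j) * f k := rfl

theorem framOp_self {j : ℕ} (hj : j ≤ n) (f : ℕ → A) :
    framOp n τ ζ j f j = algebraMap ℂ A ζ * f j := by
  simp [framOp_apply, not_lt.2 hj]

theorem framOp_lt {j k : ℕ} (hj : j ≤ n) (hk : k < j) (f : ℕ → A) :
    framOp n τ ζ j f k = τ (j - 1) * f k := by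
  rw [framOp_apply, if_neg (by omega), if_neg (by omega), if_pos hk]

theorem framOp_gt {j k : ℕ} (hk : j < k) (hn : k ≤ n) (f : ℕ → A) :
    framOp n τ ζ j f k = τ j * f k := by
  rw [framOp_apply, if_neg (by omega), if_neg (by omega), if_neg (by omega)]

theorem framOp_out {j k : ℕ} (hk : n < k) (f : ℕ → A) : framOp n τ ζ j f k = f k := by
  rw [framOp_apply, if_pos hk, one_mul]

theorem braidOp_apply (i : ℕ) (f : ℕ → A) (k : ℕ) : braidOp d n u γ τ ζ i f k =
    if n < k then u • f k else
    if k = i then f (i + 1) + eigenProj d u τ ζ i * f i else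
    if k = i + 1 then f i + eigenProj d u τ ζ i * f i else
    if k < i then γ (i - 1) * f k else γ i * f k := rfl

theorem braidOp_self {i : ℕ} (hi : i < n) (f : ℕ → A) :
    braidOp d n u γ τ ζ i f i = f (i + 1) + eigenProj d u τ ζ i * f i := by
  rw [braidOp_apply, if_neg (by omega), if_pos rfl]

theorem braidOp_succ {i : ℕ} (hi : i < n) (f : ℕ → A) :
    braidOp d n u γ τ ζ i f (i + 1) = f i + eigenProj d u τ ζ i * f i := by
  rw [braidOp_apply, if_neg (by omega), if_neg (by omega), if_pos rfl]

theorem braidOp_lt {i k : ℕ} (hi : i < n) (hk : k < i) (f : ℕ → A) :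
    braidOp d n u γ τ ζ i f k = γ (i - 1) * f k := by
  rw [braidOp_apply, if_neg (by omega), if_neg (by omega), if_neg (by omega), if_pos hk]

theorem braidOp_gt {i k : ℕ} (hk : i + 1 < k) (hn : k ≤ n) (f : ℕ → A) :
    braidOp d n u γ τ ζ i f k = γ i * f k := by
  rw [braidOp_apply, if_neg (by omega), if_neg (by omega), if_neg (by omega), if_neg (by omega)]

theorem braidOp_out {i k : ℕ} (hk : n < k) (f : ℕ → A) :
    braidOp d n u γ τ ζ i f k = u • f k := by
  rw [braidOp_apply, if_pos hk]

theorem framOp_pow_apply (j m : ℕ) (f : ℕ → A) (k : ℕ) : (framOp n τ ζ j ^ m) f k =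
    (if n < k then 1 else if k = j then algebraMap ℂ A ζ else
      if k < j then τ (j - 1) else τ j) ^ m * f k := by
  induction m generalizing f with
  | zero => simp
  | succ m ih => rw [pow_succ, Module.End.mul_apply, ih, framOp_apply, pow_succ, mul_assoc]

theorem avg_framOp_apply (i j : ℕ) (f : ℕ → A) (k : ℕ) :
    avg d (framOp n τ ζ i) (framOp n τ ζ j) f k =
      avg d (if n < k then 1 else if k = i then algebraMap ℂ A ζ else
        if k < i then τ (i - 1) else τ i)
        (if n < k then 1 else if k = j then algebraMap ℂ A ζ else
        if k < j then τ (j - 1) else τ j) * f k := by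
  simp only [avg, LinearMap.smul_apply, LinearMap.sum_apply, Pi.smul_apply, Finset.sum_apply,
    Module.End.mul_apply, modPow, framOp_pow_apply, smul_mul_assoc, Finset.sum_mul, mul_assoc]

omit [NeZero d] in
theorem algebraMap_pow_eq_one (hζ : ζ ^ d = 1) : (algebraMap ℂ A ζ) ^ d = 1 := by
  rw [← map_pow, hζ, map_one]

theorem Relations.eigenProj_comm (h : Relations d n u γ τ) {i j : ℕ} (hi : i < n) (hj : j < n) :
    eigenProj d u τ ζ i * eigenProj d u τ ζ j = eigenProj d u τ ζ j * eigenProj d u τ ζ i := by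
  have h1 : Commute (avg d (τ i) (algebraMap ℂ A ζ)) (τ j) :=
    (commute_avg_right (h.comm j i hj hi) (Algebra.commutes ζ (τ j)).symm).symm
  have h2 := commute_avg_right (d := d) h1 (Algebra.commutes ζ _).symm
  exact (h2.smul_left _).smul_right _

theorem Relations.tau_eigenProj (h : Relations d n u γ τ) {i j : ℕ} (hi : i < n) (hj : j < n) :
    Commute (τ j) (eigenProj d u τ ζ i) :=
  (commute_avg_right (h.comm j i hj hi) (Algebra.commutes ζ (τ j)).symm).smul_right _

theorem semiconj_avg_algebraMap {a b c : A} (hab : c * a = b * c) :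
    c * avg d a (algebraMap ℂ A ζ) = avg d b (algebraMap ℂ A ζ) * c := by
  have h : ∀ s : ZMod d, c * (modPow a s * modPow (algebraMap ℂ A ζ) (-s)) =
      modPow b s * modPow (algebraMap ℂ A ζ) (-s) * c := fun s =>
    SemiconjBy.mul_right (SemiconjBy.pow_right hab _)
      (SemiconjBy.pow_right (Algebra.commutes ζ c).symm _)
  simp only [avg, mul_smul_comm, smul_mul_assoc, Finset.mul_sum, Finset.sum_mul, h]

theorem gamma_eigenProj {i j k : ℕ} (hab : γ i * τ j = τ k * γ i) :
    γ i * eigenProj d u τ ζ j = eigenProj d u τ ζ k * γ i := by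
  rw [eigenProj, eigenProj, mul_smul_comm, smul_mul_assoc, semiconj_avg_algebraMap hab]

/-- On the `ζ`-eigenspace of `τ_i`, the element `τ_i` may be replaced by the scalar `ζ` inside
another average. -/
theorem Relations.avg_mul_eigenProj (h : Relations d n u γ τ) (hζ : ζ ^ d = 1) {a : A} {i : ℕ}
    (hi : i < n) :
    (u - 1) • avg d a (τ i) * avg d (τ i) (algebraMap ℂ A ζ) =
      (u - 1) • avg d a (algebraMap ℂ A ζ) * avg d (τ i) (algebraMap ℂ A ζ) := by
  rw [smul_mul_assoc, smul_mul_assoc, avg_mul_congr (mul_avg (h.modular i hi)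
    (algebraMap_pow_eq_one hζ) (Algebra.commutes ζ _).symm) (Algebra.commutes ζ _).symm]

/-- This is the identity behind the braid relation of the induced operators. Moving `γ_i` past the
projection produces `γ_i^2`; in its expansion the idempotent of the strands `i`, `i + 1` collapses
against the projection at `i + 1` to the projection at `i`. -/
theorem Relations.eigenProj_relation (h : Relations d n u γ τ) (hζ : ζ ^ d = 1) {i : ℕ}
    (hi : i + 1 < n) :
    γ i * eigenProj d u τ ζ i * γ i = eigenProj d u τ ζ (i + 1) +
      eigenProj d u τ ζ (i + 1) * eigenProj d u τ ζ i +
      eigenProj d u τ ζ i * γ i * eigenProj d u τ ζ i := by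
  have hQe : eigenProj d u τ ζ (i + 1) * ((u - 1) • avg d (τ i) (τ (i + 1))) =
      eigenProj d u τ ζ (i + 1) * eigenProj d u τ ζ i := by
    have h1 : Commute (eigenProj d u τ ζ (i + 1)) ((u - 1) • avg d (τ i) (τ (i + 1))) :=
      (commute_avg_right (h.tau_eigenProj (by omega) (by omega)).symm
        (h.tau_eigenProj (by omega) (by omega)).symm).smul_right _
    rw [h1.eq, h.eigenProj_comm (by omega) (by omega)]
    simp only [eigenProj, mul_smul_comm]
    rw [h.avg_mul_eigenProj hζ hi]
  rw [gamma_eigenProj (h.right i hi).symm, mul_assoc, h.quadratic i hi, mul_add, mul_add, mul_one,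
    ← smul_mul_assoc, ← mul_assoc, hQe, mul_assoc (eigenProj d u τ ζ i),
    gamma_eigenProj (h.right i hi).symm, ← mul_assoc,
    h.eigenProj_comm (i := i) (by omega) hi]

theorem Relations.induced_far (h : Relations d n u γ τ) {i j : ℕ} (hj : j < n) (hij : i + 1 < j) :
    braidOp d n u γ τ ζ i * braidOp d n u γ τ ζ j =
      braidOp d n u γ τ ζ j * braidOp d n u γ τ ζ i := by
  refine LinearMap.ext fun f => funext fun k => ?_
  simp only [Module.End.mul_apply]
  obtain ⟨j, rfl⟩ : ∃ j', j = j' + 1 := ⟨j - 1, by omega⟩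
  have hi : i < n := by omega
  rcases lt_or_ge n k with hk | hk
  · simp only [braidOp_out hk]
  rcases lt_trichotomy k i with h1 | rfl | h1
  · simp only [braidOp_lt hi h1, braidOp_lt hj (show k < j + 1 by omega), ← mul_assoc]
    rw [h.far (i - 1) (j + 1 - 1) (by omega) (by omega)]
  · simp only [braidOp_self hi, braidOp_lt hj (show k < j + 1 by omega),
      braidOp_lt hj (show k + 1 < j + 1 by omega), mul_add, ← mul_assoc]
    rw [gamma_eigenProj (h.other (j + 1 - 1) k (by omega) (by omega) (by omega) (by omega)).symm]
  rcases Nat.lt_or_eq_of_le (show i + 1 ≤ k by omega) with h2 | rfl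
  swap
  · simp only [braidOp_succ hi, braidOp_lt hj (show i < j + 1 by omega),
      braidOp_lt hj (show i + 1 < j + 1 by omega), mul_add, ← mul_assoc]
    rw [gamma_eigenProj (h.other (j + 1 - 1) i (by omega) (by omega) (by omega) (by omega)).symm]
  rcases lt_trichotomy k (j + 1) with h3 | rfl | h3
  · simp only [braidOp_gt h2 hk, braidOp_lt hj h3, ← mul_assoc]
    rw [h.far i (j + 1 - 1) (by omega) (by omega)]
  · simp only [braidOp_self hj, braidOp_gt (show i + 1 < j + 1 + 1 by omega)
      (show j + 1 + 1 ≤ n by omega), mul_add, braidOp_gt h2 hk, ← mul_assoc]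
    rw [gamma_eigenProj (h.other i (j + 1) (by omega) (by omega) (by omega) (by omega)).symm]
  rcases Nat.lt_or_eq_of_le (show j + 1 + 1 ≤ k by omega) with h4 | rfl
  · simp only [braidOp_gt h4 hk, braidOp_gt h2 hk, ← mul_assoc]
    rw [h.far i (j + 1) (by omega) (by omega)]
  · simp only [braidOp_succ hj, braidOp_gt (show i + 1 < j + 1 by omega)
      (show j + 1 ≤ n by omega), braidOp_gt h2 hk, mul_add, ← mul_assoc]
    rw [gamma_eigenProj (h.other i (j + 1) (by omega) (by omega) (by omega) (by omega)).symm]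

/-- Coordinates below `i` or above `i + 2` reduce to a braid relation of the `γ`. Among the three
mixed coordinates only `k = i` needs `eigenProj_relation`; the other two follow by moving
projections past `γ_i`. -/
theorem Relations.induced_braid (h : Relations d n u γ τ) (hζ : ζ ^ d = 1) {i : ℕ}
    (hi : i + 1 < n) :
    braidOp d n u γ τ ζ i * braidOp d n u γ τ ζ (i + 1) * braidOp d n u γ τ ζ i =
      braidOp d n u γ τ ζ (i + 1) * braidOp d n u γ τ ζ i * braidOp d n u γ τ ζ (i + 1) := by
  refine LinearMap.ext fun f => funext fun k => ?_
  simp only [Module.End.mul_apply]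
  have hi' : i < n := by omega
  have hP := gamma_eigenProj (d := d) (u := u) (ζ := ζ) (h.right i hi).symm
  have hQ := gamma_eigenProj (d := d) (u := u) (ζ := ζ) (h.left i hi).symm
  have hPQ := h.eigenProj_comm (ζ := ζ) hi' hi
  have hG := h.eigenProj_relation hζ hi
  rcases lt_or_ge n k with hk | hk
  · simp only [braidOp_out hk]
  rcases lt_trichotomy k i with h1 | rfl | h1
  · simp only [braidOp_lt hi' h1, braidOp_lt hi (show k < i + 1 by omega), ← mul_assoc]
    obtain ⟨i, rfl⟩ : ∃ i', i = i' + 1 := ⟨i - 1, by omega⟩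
    exact congrArg (· * f k) (h.braid i hi)
  · simp only [braidOp_self hi', braidOp_succ hi', braidOp_self hi, braidOp_lt hi (Nat.lt_add_one k),
      braidOp_gt (Nat.lt_add_one (k + 1)) (show k + 1 + 1 ≤ n from hi), Nat.add_sub_cancel, mul_add,
      ← mul_assoc]
    rw [hQ, hG]
    simp only [add_mul]
    abel
  rcases Nat.lt_or_eq_of_le (show i + 1 ≤ k by omega) with h2 | rfl
  swap
  · simp only [braidOp_self hi', braidOp_succ hi', braidOp_self hi, braidOp_succ hi,
      braidOp_lt hi (Nat.lt_add_one i),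
      braidOp_gt (Nat.lt_add_one (i + 1)) (show i + 1 + 1 ≤ n from hi), Nat.add_sub_cancel, mul_add,
      ← mul_assoc]
    rw [mul_assoc (eigenProj d u τ ζ i) (γ i) (eigenProj d u τ ζ i), hP, hQ, ← mul_assoc, hPQ]
    abel
  rcases Nat.lt_or_eq_of_le (show i + 1 + 1 ≤ k by omega) with h3 | rfl
  swap
  · simp only [braidOp_succ hi', braidOp_succ hi, braidOp_lt hi (Nat.lt_add_one i),
      braidOp_gt (Nat.lt_add_one (i + 1)) (show i + 1 + 1 ≤ n from hi), Nat.add_sub_cancel, mul_add,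
      ← mul_assoc]
    rw [hP, hQ, mul_assoc (eigenProj d u τ ζ i) (γ i) (eigenProj d u τ ζ i), hP, ← mul_assoc, hPQ]
    abel
  · simp only [braidOp_gt h2 hk, braidOp_gt h3 hk, ← mul_assoc]
    rw [h.braid i (by omega)]

theorem Relations.induced_quadratic (h : Relations d n u γ τ) {i : ℕ} (hi : i < n) :
    braidOp d n u γ τ ζ i * braidOp d n u γ τ ζ i =
      1 + (u - 1) • avg d (framOp n τ ζ i) (framOp n τ ζ (i + 1)) +
        (u - 1) • (avg d (framOp n τ ζ i) (framOp n τ ζ (i + 1)) * braidOp d n u γ τ ζ i) := by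
  refine LinearMap.ext fun f => funext fun k => ?_
  simp only [Module.End.mul_apply, LinearMap.add_apply, LinearMap.smul_apply, Pi.add_apply,
    Pi.smul_apply, avg_framOp_apply, Module.End.one_apply]
  rcases lt_or_ge n k with hk | hk
  · simp only [braidOp_out hk, if_pos hk, avg_self (one_pow d), one_mul, smul_smul]
    rw [← one_smul ℂ (f k), smul_smul, smul_smul, smul_smul, ← add_smul, ← add_smul]
    congr 1
    ring
  have hc := avg_comm (d := d) (Algebra.commutes ζ (τ i))
  rcases lt_trichotomy k i with h1 | rfl | h1
  · simp only [braidOp_lt hi h1, if_neg (not_lt.2 hk), if_neg h1.ne, if_pos h1,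
      if_neg (show k ≠ i + 1 by omega), if_pos (show k < i + 1 by omega)]
    obtain ⟨i, rfl⟩ : ∃ i', i = i' + 1 := ⟨i - 1, by omega⟩
    rw [← mul_assoc, ← mul_assoc, Nat.add_sub_cancel, h.quadratic i hi]
    simp [add_mul]
  · simp only [braidOp_self hi, braidOp_succ hi, if_neg (not_lt.2 hk), if_true,
      if_neg (show k ≠ k + 1 by omega), if_pos (show k < k + 1 by omega), Nat.add_sub_cancel, hc]
    simp only [← smul_mul_assoc]
    rfl
  rcases Nat.lt_or_eq_of_le (show i + 1 ≤ k by omega) with h2 | rfl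
  · simp only [braidOp_gt h2 hk, if_neg (not_lt.2 hk), if_neg h1.ne', if_neg h1.not_gt,
      if_neg h2.ne', if_neg h2.not_gt]
    rw [← mul_assoc, ← mul_assoc, h.quadratic i (by omega)]
    simp [add_mul]
  · simp only [braidOp_self hi, braidOp_succ hi, if_neg (not_lt.2 hk), if_true,
      if_neg (show i + 1 ≠ i by omega), if_neg (show ¬ i + 1 < i by omega)]
    simp only [← smul_mul_assoc]
    simp only [eigenProj, mul_add]
    abel

theorem Relations.induced_left (h : Relations d n u γ τ) (hζ : ζ ^ d = 1) {i : ℕ} (hi : i < n) :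
    framOp n τ ζ i * braidOp d n u γ τ ζ i = braidOp d n u γ τ ζ i * framOp n τ ζ (i + 1) := by
  have hP : τ i * eigenProj d u τ ζ i = algebraMap ℂ A ζ * eigenProj d u τ ζ i := by
    rw [eigenProj, mul_smul_comm, mul_smul_comm, mul_avg (h.modular i hi)
      (algebraMap_pow_eq_one hζ) (Algebra.commutes ζ _).symm]
  have hP' := (h.tau_eigenProj (ζ := ζ) hi hi).eq
  refine LinearMap.ext fun f => funext fun k => ?_
  simp only [Module.End.mul_apply]
  rcases lt_or_ge n k with hk | hk
  · simp only [braidOp_out hk, framOp_out hk]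
  rcases lt_trichotomy k i with h1 | rfl | h1
  · simp only [braidOp_lt hi h1, framOp_lt hi.le h1, framOp_lt hi (show k < i + 1 by omega),
      ← mul_assoc]
    obtain ⟨i, rfl⟩ : ∃ i', i = i' + 1 := ⟨i - 1, by omega⟩
    exact congrArg (· * f k) (h.left i hi)
  · simp only [braidOp_self hi, framOp_self hi.le, framOp_self (show k + 1 ≤ n from hi),
      framOp_lt (show k + 1 ≤ n from hi) (Nat.lt_add_one k), mul_add, ← mul_assoc, Nat.add_sub_cancel]
    rw [← hP', hP]
  rcases Nat.lt_or_eq_of_le (show i + 1 ≤ k by omega) with h2 | rfl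
  · simp only [braidOp_gt h2 hk, framOp_gt h1 hk, framOp_gt h2 hk, ← mul_assoc]
    rw [h.left i (by omega)]
  · simp only [braidOp_succ hi, framOp_gt h1 hk, framOp_lt hk (Nat.lt_add_one i), mul_add,
      ← mul_assoc, Nat.add_sub_cancel, hP']

theorem Relations.induced_right (h : Relations d n u γ τ) (hζ : ζ ^ d = 1) {i : ℕ} (hi : i < n) :
    framOp n τ ζ (i + 1) * braidOp d n u γ τ ζ i = braidOp d n u γ τ ζ i * framOp n τ ζ i := by
  have hP : τ i * eigenProj d u τ ζ i = algebraMap ℂ A ζ * eigenProj d u τ ζ i := by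
    rw [eigenProj, mul_smul_comm, mul_smul_comm, mul_avg (h.modular i hi)
      (algebraMap_pow_eq_one hζ) (Algebra.commutes ζ _).symm]
  have hZ := Algebra.commutes ζ (eigenProj d u τ ζ i)
  refine LinearMap.ext fun f => funext fun k => ?_
  simp only [Module.End.mul_apply]
  rcases lt_or_ge n k with hk | hk
  · simp only [braidOp_out hk, framOp_out hk]
  rcases lt_trichotomy k i with h1 | rfl | h1
  · simp only [braidOp_lt hi h1, framOp_lt hi.le h1, framOp_lt hi (show k < i + 1 by omega),
      ← mul_assoc]
    obtain ⟨i, rfl⟩ : ∃ i', i = i' + 1 := ⟨i - 1, by omega⟩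
    exact congrArg (· * f k) (h.right i hi)
  · simp only [braidOp_self hi, framOp_self hi.le, framOp_gt (Nat.lt_add_one k) hi,
      framOp_lt (show k + 1 ≤ n from hi) (Nat.lt_add_one k), mul_add, ← mul_assoc, Nat.add_sub_cancel]
    rw [hP, hZ]
  rcases Nat.lt_or_eq_of_le (show i + 1 ≤ k by omega) with h2 | rfl
  · simp only [braidOp_gt h2 hk, framOp_gt h1 hk, framOp_gt h2 hk, ← mul_assoc]
    rw [h.right i (by omega)]
  · simp only [braidOp_succ hi, framOp_self hk, framOp_self hi.le, mul_add, ← mul_assoc, hZ]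

theorem Relations.induced_other (h : Relations d n u γ τ) {i j : ℕ} (hi : i < n)
    (hj : j ≤ n) (h1 : j ≠ i) (h2 : j ≠ i + 1) :
    framOp n τ ζ j * braidOp d n u γ τ ζ i = braidOp d n u γ τ ζ i * framOp n τ ζ j := by
  refine LinearMap.ext fun f => funext fun k => ?_
  simp only [Module.End.mul_apply]
  rcases lt_or_ge n k with hk | hk
  · simp only [braidOp_out hk, framOp_out hk]
  -- On the two coordinates mixed by `g_i`, the generator `t_j` acts by one and the same element
  -- `c`, which commutes with the projection.
  obtain ⟨c, hc, hc1, hcP⟩ : ∃ c : A, framOp n τ ζ j f i = c * f i ∧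
      framOp n τ ζ j f (i + 1) = c * f (i + 1) ∧ (c * eigenProj d u τ ζ i =
        eigenProj d u τ ζ i * c ∧ (∀ f, framOp n τ ζ j f i = c * f i ∧
        framOp n τ ζ j f (i + 1) = c * f (i + 1))) := by
    rcases lt_or_ge i j with h3 | h3
    · have := fun f : ℕ → A => framOp_lt (τ := τ) (ζ := ζ) hj h3 f
      have h' := fun f : ℕ → A => framOp_lt (τ := τ) (ζ := ζ) hj (show i + 1 < j by omega) f
      exact ⟨_, this f, h' f, h.tau_eigenProj hi (by omega), fun f => ⟨this f, h' f⟩⟩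
    · have := fun f : ℕ → A => framOp_gt (τ := τ) (ζ := ζ) (show j < i by omega) hi.le f
      have h' := fun f : ℕ → A => framOp_gt (τ := τ) (ζ := ζ) (show j < i + 1 by omega) hi f
      exact ⟨_, this f, h' f, h.tau_eigenProj hi (by omega), fun f => ⟨this f, h' f⟩⟩
  obtain ⟨hcP, hcf⟩ := hcP
  rcases lt_trichotomy k i with h3 | rfl | h3
  · obtain ⟨i, rfl⟩ : ∃ i', i = i' + 1 := ⟨i - 1, by omega⟩
    rcases lt_trichotomy k j with h4 | rfl | h4
    · simp only [braidOp_lt hi h3, framOp_lt hj h4, ← mul_assoc, Nat.add_sub_cancel]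
      rw [h.other i (j - 1) hi (by omega) (by omega) (by omega)]
    · simp only [braidOp_lt hi h3, framOp_self hk, ← mul_assoc, Nat.add_sub_cancel]
      rw [Algebra.commutes]
    · simp only [braidOp_lt hi h3, framOp_gt h4 hk, ← mul_assoc, Nat.add_sub_cancel]
      rw [h.other i j hi (by omega) (by omega) (by omega)]
  · rw [(hcf _).1, braidOp_self hi, braidOp_self hi, hc, hc1, mul_add, ← mul_assoc, hcP, mul_assoc]
  rcases Nat.lt_or_eq_of_le (show i + 1 ≤ k by omega) with h4 | rfl
  · rcases lt_trichotomy k j with h5 | rfl | h5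
    · simp only [braidOp_gt h4 hk, framOp_lt hj h5, ← mul_assoc]
      rw [h.other i (j - 1) (by omega) (by omega) (by omega) (by omega)]
    · simp only [braidOp_gt h4 hk, framOp_self hk, ← mul_assoc]
      rw [Algebra.commutes]
    · simp only [braidOp_gt h4 hk, framOp_gt h5 hk, ← mul_assoc]
      rw [h.other i j (by omega) (by omega) (by omega) (by omega)]
  · rw [(hcf _).2, braidOp_succ hi, braidOp_succ hi, hc, mul_add, ← mul_assoc, hcP, mul_assoc]

theorem Relations.induced (h : Relations d n u γ τ) (hζ : ζ ^ d = 1) :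
    Relations d (n + 1) u (braidOp d n u γ τ ζ) (framOp n τ ζ) where
  far i j hj hij := h.induced_far (by omega) hij
  braid i hi := h.induced_braid hζ (by omega)
  quadratic i hi := h.induced_quadratic (by omega)
  left i hi := h.induced_left hζ (by omega)
  right i hi := h.induced_right hζ (by omega)
  other i j hi hj h1 h2 := h.induced_other (by omega) (by omega) h1 h2
  comm i j hi hj := by
    refine LinearMap.ext fun f => funext fun k => ?_
    simp only [Module.End.mul_apply, framOp_apply, ← mul_assoc]
    congr 1
    split_ifs <;> first
      | exact h.comm _ _ (by omega) (by omega)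
      | simp [Algebra.commutes]
  modular j hj := by
    refine LinearMap.ext fun f => funext fun k => ?_
    rw [framOp_pow_apply, Module.End.one_apply]
    convert one_mul (f k)
    split_ifs
    · simp
    · exact algebraMap_pow_eq_one hζ
    · exact h.modular _ (by omega)
    · exact h.modular _ (by omega)

end Induced

/-! ### The projection on the lower strands -/

section Coset

variable {d n : ℕ} [NeZero d] {u : ℂ} {A : Type*} [Ring A] [Algebra ℂ A] {γ τ : ℕ → A} {ζ : ℂ}

/-- The product `γ_k γ_{k+1} ⋯ γ_{k+m-1}`. -/
def cosetProd {A : Type*} [Monoid A] (γ : ℕ → A) : ℕ → ℕ → A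
  | _, 0 => 1
  | k, m + 1 => γ k * cosetProd γ (k + 1) m

/-- The product acts on strands as a cycle: it sends `k + m` to `k` and shifts `k, …, k + m - 1` up
by one. This and the next two lemmas are the three cases for a framing generator. -/
theorem Relations.tau_cosetProd_self (h : Relations d n u γ τ) {k m : ℕ} (hk : k + m < n) :
    τ k * cosetProd γ k m = cosetProd γ k m * τ (k + m) := by
  induction m generalizing k with
  | zero => simp [cosetProd]
  | succ m ih =>
    rw [cosetProd, ← mul_assoc, h.left k (by omega), mul_assoc, ih (by omega), ← mul_assoc]
    congr 2
    ring

theorem Relations.tau_cosetProd_lt (h : Relations d n u γ τ) {j k m : ℕ} (hj : j < k)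
    (hk : k + m < n) : τ j * cosetProd γ k m = cosetProd γ k m * τ j := by
  induction m generalizing k with
  | zero => simp [cosetProd]
  | succ m ih =>
    rw [cosetProd, ← mul_assoc, h.other k j (by omega) (by omega) (by omega) (by omega), mul_assoc,
      ih (by omega) (by omega), ← mul_assoc]

theorem Relations.tau_cosetProd_gt (h : Relations d n u γ τ) {j k m : ℕ} (hj : k < j)
    (hjm : j ≤ k + m) (hk : k + m < n) :
    τ j * cosetProd γ k m = cosetProd γ k m * τ (j - 1) := by
  induction m generalizing k with
  | zero => omega
  | succ m ih =>
    rw [cosetProd, ← mul_assoc]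
    rcases Nat.lt_or_eq_of_le (show k + 1 ≤ j by omega) with h1 | rfl
    · rw [h.other k j (by omega) (by omega) (by omega) (by omega), mul_assoc,
        ih (by omega) (by omega) (by omega), ← mul_assoc]
    · rw [h.right k (by omega), mul_assoc, h.tau_cosetProd_lt (by omega) (by omega), ← mul_assoc,
        Nat.add_sub_cancel]

theorem Relations.gamma_cosetProd_lt (h : Relations d n u γ τ) {i k m : ℕ} (hi : i + 1 < k)
    (hk : k + m < n) : γ i * cosetProd γ k m = cosetProd γ k m * γ i := by
  induction m generalizing k with
  | zero => simp [cosetProd]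
  | succ m ih =>
    rw [cosetProd, ← mul_assoc, h.far i k (by omega) (by omega), mul_assoc,
      ih (by omega) (by omega), ← mul_assoc]

/-- One braid relation, at the place where `γ_{i-1} γ_i` occurs in the product, lowers the index;
everything else commutes. -/
theorem Relations.gamma_cosetProd_gt (h : Relations d n u γ τ) {i k m : ℕ} (hi : k < i)
    (him : i < k + m) (hk : k + m < n) :
    γ i * cosetProd γ k m = cosetProd γ k m * γ (i - 1) := by
  induction m generalizing k with
  | zero => omega
  | succ m ih =>
    rcases Nat.lt_or_eq_of_le (show k + 1 ≤ i by omega) with h1 | rfl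
    · rw [cosetProd, ← mul_assoc, ← h.far k i (by omega) (by omega), mul_assoc,
        ih (by omega) (by omega) (by omega), ← mul_assoc]
    · obtain ⟨m, rfl⟩ : ∃ m', m = m' + 1 := ⟨m - 1, by omega⟩
      rw [cosetProd, cosetProd, ← mul_assoc, ← mul_assoc, ← h.braid k (by omega), mul_assoc,
        h.gamma_cosetProd_lt (by omega) (by omega), Nat.add_sub_cancel, ← mul_assoc, ← mul_assoc]

theorem semiconj_avg {a b a' b' c : A} (ha : c * a = a' * c) (hb : c * b = b' * c) :
    c * avg d a b = avg d a' b' * c := by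
  have h : ∀ s : ZMod d, c * (modPow a s * modPow b (-s)) = modPow a' s * modPow b' (-s) * c :=
    fun s => SemiconjBy.mul_right (SemiconjBy.pow_right ha _) (SemiconjBy.pow_right hb _)
  simp only [avg, mul_smul_comm, smul_mul_assoc, Finset.mul_sum, Finset.sum_mul, h]

/-- The coefficient of the coordinate `k < n` in the projection on the lower strands. -/
def cosetCoeff (d n : ℕ) [NeZero d] {A : Type*} [Ring A] [Algebra ℂ A] (γ τ : ℕ → A) (ζ : ℂ)
    (k : ℕ) : A :=
  -- The coset of `g_k ⋯ g_{n-1}` is sent to `g_k ⋯ g_{n-2}` times the `ζ`-eigenprojection of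
  -- `τ_{n-1}`. The projection is forced by `t_{n-1} g_{n-1} = g_{n-1} t_n`, where `t_n` acts by
  -- `ζ`.
  cosetProd γ k (n - 1 - k) * avg d (τ (n - 1)) (algebraMap ℂ A ζ)

/-- The projection of the induced module on the lower strands. -/
def cosetProj (d n : ℕ) [NeZero d] {A : Type*} [Ring A] [Algebra ℂ A] (γ τ : ℕ → A) (ζ : ℂ) :
    (ℕ → A) →ₗ[ℂ] A :=
  -- The coordinate `k = n`, the trivial coset, is left out; the trace treats it separately.
  ∑ k ∈ Finset.range n, (LinearMap.mulLeft ℂ (cosetCoeff d n γ τ ζ k)).comp (LinearMap.proj k)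

theorem cosetProj_apply (f : ℕ → A) : cosetProj d n γ τ ζ f =
    ∑ k ∈ Finset.range n, cosetCoeff d n γ τ ζ k * f k := by
  simp [cosetProj]

theorem Relations.tau_avg_last (h : Relations d n u γ τ) {j : ℕ} (hj : j < n) :
    τ j * avg d (τ (n - 1)) (algebraMap ℂ A ζ) = avg d (τ (n - 1)) (algebraMap ℂ A ζ) * τ j :=
  commute_avg_right (h.comm j (n - 1) hj (by omega)) (Algebra.commutes ζ (τ j)).symm

theorem Relations.gamma_avg_last (h : Relations d n u γ τ) {i : ℕ} (hi : i + 2 < n) :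
    γ i * avg d (τ (n - 1)) (algebraMap ℂ A ζ) = avg d (τ (n - 1)) (algebraMap ℂ A ζ) * γ i :=
  semiconj_avg_algebraMap (h.other i (n - 1) (by omega) (by omega) (by omega) (by omega)).symm

theorem Relations.cosetProj_framOp (h : Relations d n u γ τ) (hζ : ζ ^ d = 1) {j : ℕ} (hj : j < n)
    (f : ℕ → A) :
    cosetProj d n γ τ ζ (framOp n τ ζ j f) = τ j * cosetProj d n γ τ ζ f := by
  rw [cosetProj_apply, cosetProj_apply, Finset.mul_sum]
  refine Finset.sum_congr rfl fun k hk => ?_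
  have hk := Finset.mem_range.1 hk
  rw [cosetCoeff]
  rcases lt_trichotomy k j with h1 | rfl | h1
  · rw [framOp_lt hj.le h1, ← mul_assoc, ← mul_assoc, ← mul_assoc,
      h.tau_cosetProd_gt h1 (by omega) (by omega), mul_assoc _ _ (τ (j - 1)),
      ← h.tau_avg_last (by omega), mul_assoc _ (τ (j - 1))]
  -- Here the eigenprojection is essential: `τ_j` emerges on the right as `τ_{n-1}`, which the
  -- projection identifies with `ζ`.
  · rw [framOp_self hj.le, ← mul_assoc, ← mul_assoc, ← mul_assoc, h.tau_cosetProd_self (by omega),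
      mul_assoc _ _ (algebraMap ℂ A ζ), ← Algebra.commutes,
      ← mul_avg (h.modular _ (by omega)) (algebraMap_pow_eq_one hζ) (Algebra.commutes ζ _).symm,
      ← mul_assoc, show k + (n - 1 - k) = n - 1 by omega]
  · rw [framOp_gt h1 hk.le, ← mul_assoc, ← mul_assoc, ← mul_assoc,
      h.tau_cosetProd_lt h1 (by omega), mul_assoc _ _ (τ j),
      ← h.tau_avg_last (by omega), mul_assoc _ (τ j)]

/-- Suited to `braidOp`, which mixes only the coordinates `i` and `i + 1`: other terms are compared
singly, these two as a sum. -/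
theorem sum_range_eq_of_pair {M : Type*} [AddCommGroup M] {n i : ℕ} (hi : i + 1 < n)
    {f f' : ℕ → M} (h : ∀ k < n, k ≠ i → k ≠ i + 1 → f k = f' k)
    (hp : f i + f (i + 1) = f' i + f' (i + 1)) :
    ∑ k ∈ Finset.range n, f k = ∑ k ∈ Finset.range n, f' k := by
  rw [← sub_eq_zero, ← Finset.sum_sub_distrib, ← Finset.sum_subset (s₁ := {i, i + 1})]
  · rw [Finset.sum_pair (by omega), sub_add_sub_comm, hp, sub_self]
  · intro k hk
    simp only [Finset.mem_insert, Finset.mem_singleton] at hk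
    exact Finset.mem_range.2 (by omega)
  · intro k hk hk'
    simp only [Finset.mem_insert, Finset.mem_singleton, not_or] at hk'
    rw [h k (Finset.mem_range.1 hk) hk'.1 hk'.2, sub_self]

theorem Relations.cosetProj_braidOp (h : Relations d n u γ τ) (hζ : ζ ^ d = 1) {i : ℕ}
    (hi : i + 1 < n) (f : ℕ → A) :
    cosetProj d n γ τ ζ (braidOp d n u γ τ ζ i f) = γ i * cosetProj d n γ τ ζ f := by
  rw [cosetProj_apply, cosetProj_apply, Finset.mul_sum]
  have hi' : i < n := by omega
  refine sum_range_eq_of_pair hi (fun k hk h1 h2 => ?_) ?_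
  · rw [cosetCoeff]
    rcases Nat.lt_or_gt_of_ne h1 with h1 | h1
    · rw [braidOp_lt hi' h1, ← mul_assoc, ← mul_assoc, ← mul_assoc,
        h.gamma_cosetProd_gt h1 (by omega) (by omega), mul_assoc _ _ (γ (i - 1)),
        ← h.gamma_avg_last (by omega), mul_assoc _ (γ (i - 1))]
    · rw [braidOp_gt (by omega) hk.le, ← mul_assoc, ← mul_assoc, ← mul_assoc,
        h.gamma_cosetProd_lt (by omega) (by omega), mul_assoc _ _ (γ i),
        ← h.gamma_avg_last (by omega), mul_assoc _ (γ i)]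
  · rw [braidOp_self hi', braidOp_succ hi']
    -- The coefficients satisfy the same rules as the cosets: `hC` mirrors `g_i v_{i+1} = v_i`, and
    -- `hGG` mirrors the formula for `g_i v_i`.
    have hC : γ i * cosetCoeff d n γ τ ζ (i + 1) = cosetCoeff d n γ τ ζ i := by
      rw [cosetCoeff, cosetCoeff, show n - 1 - i = n - 1 - (i + 1) + 1 by omega, cosetProd,
        mul_assoc]
    set c := cosetProd γ (i + 1) (n - 1 - (i + 1)) with hc
    set F := avg d (τ (n - 1)) (algebraMap ℂ A ζ) with hF
    have hP : Commute F (eigenProj d u τ ζ i) :=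
      (commute_avg_right (h.tau_eigenProj hi' (by omega)).symm
        (Algebra.commutes ζ _).symm).symm
    have hci : τ i * c = c * τ i := h.tau_cosetProd_lt (by omega) (by omega)
    have hci1 : τ (i + 1) * c = c * τ (n - 1) := by
      rw [hc, h.tau_cosetProd_self (by omega)]; congr 2; omega
    have hec : avg d (τ i) (τ (i + 1)) * c = c * avg d (τ i) (τ (n - 1)) :=
      (semiconj_avg hci.symm hci1.symm).symm
    have heF : (u - 1) • avg d (τ i) (τ (n - 1)) * F = eigenProj d u τ ζ i * F :=
      h.avg_mul_eigenProj hζ (by omega)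
    have hE : (u - 1) • avg d (τ i) (τ (i + 1)) * cosetCoeff d n γ τ ζ (i + 1) =
        cosetCoeff d n γ τ ζ (i + 1) * eigenProj d u τ ζ i := by
      rw [cosetCoeff, ← hc, ← hF, mul_assoc c, hP.eq, ← heF, smul_mul_assoc, ← mul_assoc, hec,
        mul_assoc, smul_mul_assoc, mul_smul_comm]
    have heG : (u - 1) • avg d (τ i) (τ (i + 1)) * γ i =
        γ i * (u - 1) • avg d (τ i) (τ (i + 1)) := by
      rw [mul_smul_comm, semiconj_avg (h.right i hi).symm (h.left i hi).symm,
        avg_comm (h.comm (i + 1) i hi hi'), smul_mul_assoc]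
    have hGG : γ i * cosetCoeff d n γ τ ζ i = cosetCoeff d n γ τ ζ (i + 1) +
        cosetCoeff d n γ τ ζ (i + 1) * eigenProj d u τ ζ i +
        cosetCoeff d n γ τ ζ i * eigenProj d u τ ζ i := by
      rw [← hC, ← mul_assoc, h.quadratic i hi, add_mul, add_mul, one_mul, hE, ← smul_mul_assoc,
        heG, mul_assoc, hE, mul_assoc]
    rw [← mul_assoc, ← mul_assoc, hGG, hC]
    simp only [mul_add, add_mul, ← mul_assoc]
    abel

end Coset

/-! ### Fourier analysis on `ZMod d` -/

section Fourier

variable {d : ℕ} [NeZero d]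

/-- The `d`-th roots of unity. -/
def root (d : ℕ) [NeZero d] (a : ZMod d) : ℂ := ZMod.stdAddChar a

theorem root_add (a b : ZMod d) : root d (a + b) = root d a * root d b :=
  AddChar.map_add_eq_mul _ _ _

theorem root_zero : root d 0 = 1 := AddChar.map_zero_eq_one _

theorem root_pow (a : ZMod d) (m : ℕ) : root d a ^ m = root d (a * m) := by
  rw [mul_comm, ← nsmul_eq_mul]; exact (AddChar.map_nsmul_eq_pow _ _ _).symm

theorem root_pow_eq_one (a : ZMod d) : root d a ^ d = 1 := by
  rw [root_pow]; simp [root_zero]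

theorem modPow_root (a m : ZMod d) : modPow (root d a) m = root d (a * m) := by
  rw [modPow, root_pow, ZMod.natCast_zmod_val]

theorem sum_root_mul (m : ZMod d) : ∑ a : ZMod d, root d (a * m) = if m = 0 then (d : ℂ) else 0 := by
  have := AddChar.sum_mulShift m (ZMod.isPrimitive_stdAddChar d)
  rw [ZMod.card] at this
  exact_mod_cast this

/-- The Fourier coefficients of `x`. -/
def weight (x : ZMod d → ℂ) (a : ZMod d) : ℂ := (1 / (d : ℂ)) * ∑ m : ZMod d, x m * root d (a * -m)

theorem natCast_ne_zero_complex : (d : ℂ) ≠ 0 := Nat.cast_ne_zero.2 (NeZero.ne d)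

/-- Fourier inversion: weighting the representations with `t_n ↦ ζ` by these coefficients gives
`t_n^l` the value `x_l`. -/
theorem sum_weight_mul_root (x : ZMod d → ℂ) (l : ZMod d) :
    ∑ a : ZMod d, weight x a * root d (a * l) = x l := by
  have h1 : ∀ a : ZMod d, weight x a * root d (a * l) =
      (1 / (d : ℂ)) * ∑ m : ZMod d, x m * root d (a * (l - m)) := fun a => by
    rw [weight, mul_assoc, Finset.sum_mul]
    congr 1
    refine Finset.sum_congr rfl fun m _ => ?_
    rw [mul_assoc, ← root_add, ← mul_add, neg_add_eq_sub]
  simp only [h1]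
  rw [← Finset.mul_sum, Finset.sum_comm]
  simp only [← Finset.mul_sum, sum_root_mul, sub_eq_zero, mul_ite, mul_zero, Finset.sum_ite_eq,
    Finset.mem_univ, if_true]
  rw [mul_comm (x l), ← mul_assoc, one_div, inv_mul_cancel₀ natCast_ne_zero_complex, one_mul]

/-- Orthogonality of characters kills every power of `t` but the zeroth, so the eigenprojections
form a resolution of the identity. -/
theorem sum_avg_root {A : Type*} [Ring A] [Algebra ℂ A] (t : A) :
    ∑ a : ZMod d, avg d t (algebraMap ℂ A (root d a)) = 1 := by
  simp only [avg, ← map_modPow, modPow_root]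
  rw [← Finset.smul_sum, Finset.sum_comm]
  simp only [← Finset.mul_sum, ← map_sum, sum_root_mul, neg_eq_zero]
  rw [Finset.sum_eq_single 0 (fun s _ hs => by simp [hs]) (by simp), if_pos rfl, modPow_zero,
    one_mul, Algebra.smul_def, ← map_mul, one_div, inv_mul_cancel₀ natCast_ne_zero_complex, map_one]

end Fourier

/-! ### Construction of the trace -/

section Trace

variable {d n : ℕ} [NeZero d] {u : ℂ}

/-- The induced representation of `Y_{d,n+1}(u)` attached to the `a`-th root of unity. -/
def indRep (d n : ℕ) [NeZero d] (u : ℂ) (a : ZMod d) :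
    Y d (n + 1) u →ₐ[ℂ] Module.End ℂ (ℕ → Y d n u) :=
  ((relations_Y (d := d) (n := n) (u := u)).induced (root_pow_eq_one a)).lift

theorem indRep_G (a : ZMod d) {i : ℕ} (hi : i < n) : indRep d n u a (G d (n + 1) u i) =
    braidOp d n u (G d n u) (T d n u) (root d a) i :=
  Relations.lift_G _ (by omega)

theorem indRep_T (a : ZMod d) {j : ℕ} (hj : j ≤ n) : indRep d n u a (T d (n + 1) u j) =
    framOp n (T d n u) (root d a) j :=
  Relations.lift_T _ (by omega)

omit [NeZero d] in
theorem map_smul_of_generators {M : Type*} [AddCommGroup M] [Module ℂ M]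
    (Φ : Y d n u →ₐ[ℂ] Module.End ℂ M) (L : M →ₗ[ℂ] Y d n u)
    (hG : ∀ i, i + 1 < n → ∀ f, L (Φ (G d n u i) f) = G d n u i * L f)
    (hT : ∀ j, j < n → ∀ f, L (Φ (T d n u j) f) = T d n u j * L f) (b : Y d n u) (f : M) :
    L (Φ b f) = b * L f := by
  let U : Subalgebra ℂ (Y d n u) :=
    { carrier := {b | ∀ f, L (Φ b f) = b * L f}
      mul_mem' := fun {a b} ha hb f => by
        rw [map_mul, Module.End.mul_apply, ha, hb, mul_assoc]
      add_mem' := fun {a b} ha hb f => by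
        rw [map_add, LinearMap.add_apply, map_add, ha, hb, add_mul]
      algebraMap_mem' := fun r f => by
        rw [AlgHom.commutes, Module.algebraMap_end_apply, map_smul, Algebra.smul_def] }
  exact mem_subalgebra U hG hT b f

omit [NeZero d] in
theorem smul_map_of_generators {M : Type*} [AddCommGroup M] [Module ℂ M]
    (Φ : Y d n u →ₐ[ℂ] Module.End ℂ M) (L : Y d n u →ₗ[ℂ] M)
    (hG : ∀ i, i + 1 < n → ∀ c, Φ (G d n u i) (L c) = L (G d n u i * c))
    (hT : ∀ j, j < n → ∀ c, Φ (T d n u j) (L c) = L (T d n u j * c)) (b c : Y d n u) :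
    Φ b (L c) = L (b * c) := by
  let U : Subalgebra ℂ (Y d n u) :=
    { carrier := {b | ∀ c, Φ b (L c) = L (b * c)}
      mul_mem' := fun {a b} ha hb f => by
        rw [map_mul, Module.End.mul_apply, hb, ha, mul_assoc]
      add_mem' := fun {a b} ha hb f => by
        rw [map_add, LinearMap.add_apply, ha, hb, add_mul, map_add]
      algebraMap_mem' := fun r f => by
        rw [AlgHom.commutes, Module.algebraMap_end_apply, ← map_smul, Algebra.smul_def] }
  exact mem_subalgebra U hG hT b c

/-- A generator on the first `n` strands does not mix the trivial coset with the others. -/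
theorem indRep_incl_top (a : ZMod d) (b : Y d n u) (f : ℕ → Y d n u) :
    indRep d n u a (incl d n u b) f n = b * f n :=
  map_smul_of_generators ((indRep d n u a).comp (incl d n u)) (LinearMap.proj n)
    (fun i hi f => by
      simp only [AlgHom.comp_apply, incl_G hi, indRep_G a (show i < n by omega),
        LinearMap.proj_apply]
      exact braidOp_gt hi le_rfl f)
    (fun j hj f => by
      simp only [AlgHom.comp_apply, incl_T hj, indRep_T a hj.le, LinearMap.proj_apply]
      exact framOp_gt hj le_rfl f) b f

theorem cosetProj_indRep_incl (a : ZMod d) (b : Y d n u) (f : ℕ → Y d n u) :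
    cosetProj d n (G d n u) (T d n u) (root d a) (indRep d n u a (incl d n u b) f) =
      b * cosetProj d n (G d n u) (T d n u) (root d a) f :=
  map_smul_of_generators ((indRep d n u a).comp (incl d n u)) (cosetProj d n _ _ _)
    (fun i hi f => by
      simp only [AlgHom.comp_apply, incl_G hi, indRep_G a (show i < n by omega)]
      exact relations_Y.cosetProj_braidOp (root_pow_eq_one a) hi f)
    (fun j hj f => by
      simp only [AlgHom.comp_apply, incl_T hj, indRep_T a hj.le]
      exact relations_Y.cosetProj_framOp (root_pow_eq_one a) hj f) b f

theorem indRep_incl_single (a : ZMod d) (b c : Y d n u) :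
    indRep d n u a (incl d n u b) (Pi.single n c) = Pi.single n (b * c) :=
  smul_map_of_generators ((indRep d n u a).comp (incl d n u))
    (LinearMap.single ℂ (fun _ : ℕ => Y d n u) n)
    (fun i hi c => by
      simp only [AlgHom.comp_apply, incl_G hi, indRep_G a (show i < n by omega),
        LinearMap.single_apply]
      ext k
      rcases eq_or_ne k n with rfl | hk
      · rw [braidOp_gt hi le_rfl, Pi.single_eq_same, Pi.single_eq_same]
      · rw [braidOp_apply]
        simp [hk, show i ≠ n by omega, show i + 1 ≠ n by omega])
    (fun j hj c => by
      simp only [AlgHom.comp_apply, incl_T hj, indRep_T a hj.le, LinearMap.single_apply]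
      ext k
      rcases eq_or_ne k n with rfl | hk
      · rw [framOp_gt hj le_rfl, Pi.single_eq_same, Pi.single_eq_same]
      · rw [framOp_apply]
        simp [hk]) b c

theorem indRep_modPow_single (a m : ZMod d) (c : Y d n u) :
    indRep d n u a (modPow (T d (n + 1) u n) m) (Pi.single n c) =
      root d (a * m) • Pi.single n c := by
  rw [map_modPow, indRep_T a le_rfl]
  ext k
  rw [modPow, framOp_pow_apply, Pi.smul_apply]
  rcases eq_or_ne k n with rfl | hk
  · rw [if_neg (lt_irrefl _), if_pos rfl, ← map_pow, ← Algebra.smul_def, root_pow,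
      ZMod.natCast_zmod_val]
  · simp [hk]

theorem indRep_G_single (a : ZMod d) {i : ℕ} (hi : i + 1 = n) (c : Y d n u) :
    indRep d n u a (G d (n + 1) u i) (Pi.single n c) = Pi.single i c := by
  subst hi
  rw [indRep_G a (by omega)]
  ext k
  rw [braidOp_apply]
  by_cases h1 : k = i
  · subst h1; simp
  by_cases h2 : k = i + 1
  · subst h2; simp
  simp [h1, h2]

/-- One step of the recursive construction of the Juyumaya trace. -/
def traceSucc (z : ℂ) (x : ZMod d → ℂ) (τ : Y d n u →ₗ[ℂ] ℂ) : Y d (n + 1) u →ₗ[ℂ] ℂ :=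
  -- The element is applied to the cyclic vector `v_n`. The trivial coset carries the Fourier
  -- weight, and the others, after deletion of `g_{n-1}`, carry `z`.
  ∑ a : ZMod d, (weight x a • τ.comp (LinearMap.proj n) +
      z • τ.comp (cosetProj d n (G d n u) (T d n u) (root d a))).comp
    ((LinearMap.applyₗ (Pi.single n (1 : Y d n u) : ℕ → Y d n u)).comp
      (indRep d n u a).toLinearMap)

theorem traceSucc_apply (z : ℂ) (x : ZMod d → ℂ) (τ : Y d n u →ₗ[ℂ] ℂ) (y : Y d (n + 1) u) :
    traceSucc z x τ y = ∑ a : ZMod d, (weight x a * τ (indRep d n u a y (Pi.single n 1) n) +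
      z * τ (cosetProj d n (G d n u) (T d n u) (root d a) (indRep d n u a y (Pi.single n 1)))) := by
  simp [traceSucc]

theorem cosetProj_single_top {A : Type*} [Ring A] [Algebra ℂ A] (γ τ : ℕ → A) (ζ : ℂ) (c : A) :
    cosetProj d n γ τ ζ (Pi.single n c) = 0 := by
  rw [cosetProj_apply]
  refine Finset.sum_eq_zero fun k hk => ?_
  rw [Pi.single_eq_of_ne (Finset.mem_range.1 hk).ne, mul_zero]

theorem cosetProj_single_pred {A : Type*} [Ring A] [Algebra ℂ A] (γ τ : ℕ → A) (ζ : ℂ) (c : A)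
    {i : ℕ} (hi : i + 1 = n) :
    cosetProj d n γ τ ζ (Pi.single i c) = avg d (τ i) (algebraMap ℂ A ζ) * c := by
  subst hi
  rw [cosetProj_apply, Finset.sum_eq_single i (fun k _ hk => by simp [hk]) (by simp),
    Pi.single_eq_same, cosetCoeff]
  simp [cosetProd]

theorem traceSucc_framing (z : ℂ) (x : ZMod d → ℂ) (τ : Y d n u →ₗ[ℂ] ℂ) (a b : Y d n u)
    (m : ZMod d) :
    traceSucc z x τ (incl d n u a * modPow (T d (n + 1) u n) m * incl d n u b) =
      x m * τ (a * b) := by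
  rw [traceSucc_apply, ← sum_weight_mul_root x m, Finset.sum_mul]
  refine Finset.sum_congr rfl fun c _ => ?_
  simp only [map_mul, Module.End.mul_apply, indRep_incl_single, mul_one, indRep_modPow_single,
    map_smul, cosetProj_single_top, map_zero, smul_zero, mul_zero, add_zero, Pi.smul_apply,
    Pi.single_eq_same, smul_eq_mul, mul_assoc]

/-- The vector `a g_{n-1} b v_n` has no component on the trivial coset, and its projection is `a F
b` with `F` an eigenprojection of `t_{n-1}`; these sum to `a b` over all roots of unity. -/
theorem traceSucc_braid (z : ℂ) (x : ZMod d → ℂ) (τ : Y d n u →ₗ[ℂ] ℂ) (a b : Y d n u) {i : ℕ}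
    (hi : i + 1 = n) :
    traceSucc z x τ (incl d n u a * G d (n + 1) u i * incl d n u b) = z * τ (a * b) := by
  rw [traceSucc_apply]
  simp only [map_mul, Module.End.mul_apply, indRep_incl_single, mul_one, indRep_G_single _ hi,
    indRep_incl_top, cosetProj_indRep_incl, cosetProj_single_pred _ _ _ _ hi]
  simp only [Pi.single_eq_of_ne (show n ≠ i by omega), mul_zero, map_zero, zero_add]
  rw [← Finset.mul_sum, ← map_sum, ← Finset.mul_sum, ← Finset.sum_mul, sum_avg_root, one_mul]

/-- The Juyumaya trace. -/
def juyumayaTrace (d : ℕ) [NeZero d] (u z : ℂ) (x : ZMod d → ℂ) : (n : ℕ) → Y d n u →ₗ[ℂ] ℂ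
  -- There are no generators on zero strands, so every relation is vacuous.
  | 0 => ((RingQuot.liftAlgHom ℂ ⟨FreeAlgebra.lift ℂ (fun _ => 0), fun a b h => by
      cases h with
      | far i j hi hj hij => omega
      | braid i hi hi' => omega
      | framing_comm j k => exact j.elim0
      | mixed i hi j => omega
      | modular j => exact j.elim0
      | quadratic i hi => omega⟩ : Y d 0 u →ₐ[ℂ] ℂ)).toLinearMap
  | n + 1 => traceSucc z x (juyumayaTrace d u z x n)

end Trace

/-! ### Markov traces are traces -/

/-- The bimodule form of the Markov and framing conditions. -/
structure IsMarkov (d : ℕ) (u z : ℂ) (x : ZMod d → ℂ) (tr : (n : ℕ) → Y d n u →ₗ[ℂ] ℂ) : Prop where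
  one : tr 0 1 = 1
  framing : ∀ (n : ℕ) (a b : Y d n u) (m : ZMod d),
    tr (n + 1) (incl d n u a * modPow (T d (n + 1) u n) m * incl d n u b) = x m * tr n (a * b)
  braid : ∀ (n i : ℕ), i + 1 = n → ∀ a b : Y d n u,
    tr (n + 1) (incl d n u a * G d (n + 1) u i * incl d n u b) = z * tr n (a * b)

section Markov

variable {d n : ℕ} [NeZero d] {u z : ℂ} {x : ZMod d → ℂ} {tr : (n : ℕ) → Y d n u →ₗ[ℂ] ℂ}

theorem isMarkov_juyumayaTrace (d : ℕ) [NeZero d] (u z : ℂ) (x : ZMod d → ℂ) :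
    IsMarkov d u z x (juyumayaTrace d u z x) where
  one := by simp [juyumayaTrace]
  framing _ a b m := traceSucc_framing z x _ a b m
  braid _ _ hi a b := traceSucc_braid z x _ a b hi

theorem avg_mul_G {i : ℕ} (hi : i + 1 < n) :
    avg d (T d n u i) (T d n u (i + 1)) * G d n u i =
      G d n u i * avg d (T d n u i) (T d n u (i + 1)) := by
  rw [semiconj_avg (relations_Y.right i hi).symm (relations_Y.left i hi).symm,
    avg_comm (T_comm (i + 1) i)]

theorem modPow_T_commute (i j : ℕ) (s r : ZMod d) :
    modPow (T d n u i) s * modPow (T d n u j) r = modPow (T d n u j) r * modPow (T d n u i) s :=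
  commute_modPow_left (commute_modPow_right (T_comm i j) r) s

/-- The expansion is arranged so that each term has either a power of `t_{n+1}` or one `g_n` flanked
by lower-strand factors, ready for the Markov rules. -/
theorem modPow_mul_G_mul_G (m : ZMod d) :
    modPow (T d (n + 2) u (n + 1)) m * (G d (n + 2) u n * G d (n + 2) u n) =
      modPow (T d (n + 2) u (n + 1)) m +
      ((u - 1) * (1 / (d : ℂ))) • ∑ s : ZMod d,
        modPow (T d (n + 2) u n) s * modPow (T d (n + 2) u (n + 1)) (m - s) +
      ((u - 1) * (1 / (d : ℂ))) • ∑ s : ZMod d,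
        modPow (T d (n + 2) u n) s * G d (n + 2) u n * modPow (T d (n + 2) u n) (m - s) := by
  have h : modPow (T d (n + 2) u (n + 1)) m * avg d (T d (n + 2) u n) (T d (n + 2) u (n + 1)) =
      (1 / (d : ℂ)) • ∑ s : ZMod d,
        modPow (T d (n + 2) u n) s * modPow (T d (n + 2) u (n + 1)) (m - s) := by
    rw [avg, mul_smul_comm, Finset.mul_sum]
    congr 1
    refine Finset.sum_congr rfl fun s _ => ?_
    rw [← mul_assoc, modPow_T_commute, mul_assoc, ← modPow_add T_pow, sub_eq_add_neg]
  rw [relations_Y.quadratic n (by omega), mul_add, mul_add, mul_one, mul_smul_comm, mul_smul_comm,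
    ← mul_assoc, h, smul_mul_assoc, Finset.sum_mul, smul_smul, smul_smul]
  congr 2
  refine Finset.sum_congr rfl fun s _ => ?_
  rw [mul_assoc, ← G_mul_modPow_left (by omega), mul_assoc]

/-- The trace of `a t_{n+1}^m g_n^2 b`. -/
theorem IsMarkov.trace_framing_G_G (h : IsMarkov d u z x tr) (a b : Y d (n + 1) u) (m : ZMod d) :
    tr (n + 2) (incl d (n + 1) u a * (modPow (T d (n + 2) u (n + 1)) m *
      (G d (n + 2) u n * G d (n + 2) u n)) * incl d (n + 1) u b) =
    x m * tr (n + 1) (a * b) + ((u - 1) * (1 / (d : ℂ))) * ∑ s : ZMod d,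
        x (m - s) * tr (n + 1) (a * modPow (T d (n + 1) u n) s * b) +
      (u - 1) * z * tr (n + 1) (a * modPow (T d (n + 1) u n) m * b) := by
  have hd := natCast_ne_zero_complex (d := d)
  have h1 : ∀ s : ZMod d, tr (n + 2) (incl d (n + 1) u a * (modPow (T d (n + 2) u n) s *
      modPow (T d (n + 2) u (n + 1)) (m - s)) * incl d (n + 1) u b) =
      x (m - s) * tr (n + 1) (a * modPow (T d (n + 1) u n) s * b) := fun s => by
    rw [← mul_assoc, ← incl_modPow (by omega), ← map_mul, h.framing]
  have h2 : ∀ s : ZMod d, tr (n + 2) (incl d (n + 1) u a * (modPow (T d (n + 2) u n) s *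
      G d (n + 2) u n * modPow (T d (n + 2) u n) (m - s)) * incl d (n + 1) u b) =
      z * tr (n + 1) (a * modPow (T d (n + 1) u n) m * b) := fun s => by
    have := h.braid (n + 1) n rfl (a * modPow (T d (n + 1) u n) s)
      (modPow (T d (n + 1) u n) (m - s) * b)
    rw [mul_assoc a, ← mul_assoc (modPow _ _) (modPow _ _), ← modPow_add T_pow, add_sub_cancel] at this
    simpa only [map_mul, incl_modPow (Nat.lt_add_one n), mul_assoc] using this
  rw [modPow_mul_G_mul_G]
  simp only [mul_add, add_mul, mul_smul_comm, smul_mul_assoc, Finset.mul_sum, Finset.sum_mul,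
    map_add, map_smul, map_sum, h1, h2, h.framing, smul_eq_mul, Finset.sum_const, Finset.card_univ,
    ZMod.card, nsmul_eq_mul]
  congr 1
  field_simp

theorem G_incl_G (a₁ a₂ : Y d n u) (y w : Y d (n + 1) u) :
    G d (n + 2) u n * incl d (n + 1) u (incl d n u a₁ * y * incl d n u a₂) * G d (n + 2) u n *
      incl d (n + 1) u w = incl d (n + 1) u (incl d n u a₁) *
      (G d (n + 2) u n * incl d (n + 1) u y * G d (n + 2) u n) *
      incl d (n + 1) u (incl d n u a₂ * w) := by
  simp only [map_mul, ← mul_assoc, (G_commute_incl_incl a₁).eq]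
  simp only [mul_assoc]
  simp only [← mul_assoc _ _ (incl d (n + 1) u w), (G_commute_incl_incl a₂).eq]

/-- Since `a₁` and `a₂` commute with `g_n`, the core is `g_n t_n^m g_n = t_{n+1}^m g_n^2`. -/
theorem IsMarkov.trace_G_framing_G (h : IsMarkov d u z x tr) (a₁ a₂ : Y d n u) (m : ZMod d)
    (b : Y d (n + 1) u) :
    tr (n + 2) (G d (n + 2) u n * incl d (n + 1) u
      (incl d n u a₁ * modPow (T d (n + 1) u n) m * incl d n u a₂) * G d (n + 2) u n *
      incl d (n + 1) u b) =
    x m * tr (n + 1) (incl d n u a₁ * incl d n u a₂ * b) + ((u - 1) * (1 / (d : ℂ))) *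
      ∑ s : ZMod d, x (m - s) *
        tr (n + 1) (incl d n u a₁ * modPow (T d (n + 1) u n) s * incl d n u a₂ * b) +
      (u - 1) * z * tr (n + 1) (incl d n u a₁ * modPow (T d (n + 1) u n) m * incl d n u a₂ * b) := by
  rw [G_incl_G, incl_modPow (by omega), G_mul_modPow_left (by omega), mul_assoc (modPow _ _),
    h.trace_framing_G_G]
  simp only [mul_assoc]

/-- The braid relation rewrites `g_n g_{n-1} g_n` as `g_{n-1} g_n g_{n-1}`, and the Markov rule
replaces the single `g_n` by `z`. -/
theorem IsMarkov.trace_G_braid_G (h : IsMarkov d u z x tr) (a₁ a₂ : Y d n u) {i : ℕ}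
    (hi : i + 1 = n) (b : Y d (n + 1) u) :
    tr (n + 2) (G d (n + 2) u n * incl d (n + 1) u
      (incl d n u a₁ * G d (n + 1) u i * incl d n u a₂) * G d (n + 2) u n *
      incl d (n + 1) u b) =
    z * tr (n + 1) (incl d n u a₁ * (G d (n + 1) u i * G d (n + 1) u i) * incl d n u a₂ * b) := by
  subst hi
  have := h.braid (i + 1 + 1) (i + 1) rfl (incl d (i + 1) u a₁ * G d (i + 2) u i)
    (G d (i + 2) u i * (incl d (i + 1) u a₂ * b))
  rw [G_incl_G, incl_G (by omega), ← relations_Y.braid i (by omega)]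
  simp only [map_mul, incl_G (show i + 1 < i + 1 + 1 by omega), mul_assoc] at this ⊢
  exact this

theorem modPow_mul_G_incl {i : ℕ} (s : ZMod d) (y : Y d (i + 2) u) :
    modPow (T d (i + 2) u (i + 1)) s * (G d (i + 2) u i * y) =
      G d (i + 2) u i * (incl d (i + 1) u (modPow (T d (i + 1) u i) s) * y) := by
  rw [← mul_assoc, ← G_mul_modPow_left (by omega), incl_modPow (by omega), mul_assoc]

theorem modPow_mul_incl (a : Y d n u) (s : ZMod d) (y : Y d (n + 1) u) :
    modPow (T d (n + 1) u n) s * (incl d n u a * y) =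
      incl d n u a * (modPow (T d (n + 1) u n) s * y) := by
  rw [← mul_assoc, (modPow_commute_incl a s).eq, mul_assoc]

/-- Interchanging `g_i` and `g_i^2` in the trace of `g_i^2 c g_i c'`. -/
theorem IsMarkov.trace_G_G_incl_G (h : IsMarkov d u z x tr) {i : ℕ}
    (hc : ∀ a b : Y d (i + 2) u, tr (i + 2) (a * b) = tr (i + 2) (b * a)) (c c' : Y d (i + 1) u) :
    tr (i + 2) (G d (i + 2) u i * G d (i + 2) u i * (incl d (i + 1) u c * (G d (i + 2) u i *
      incl d (i + 1) u c'))) =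
    tr (i + 2) (G d (i + 2) u i * (incl d (i + 1) u c * (G d (i + 2) u i * G d (i + 2) u i *
      incl d (i + 1) u c'))) := by
  have h1 : tr (i + 2) (incl d (i + 1) u c * (G d (i + 2) u i * incl d (i + 1) u c')) =
      tr (i + 2) (G d (i + 2) u i * (incl d (i + 1) u c * incl d (i + 1) u c')) := by
    have e1 := h.braid (i + 1) i rfl c c'
    have e2 := h.braid (i + 1) i rfl 1 (c * c')
    rw [map_one, one_mul, one_mul] at e2
    rw [← mul_assoc, e1, ← map_mul, e2]
  have h2 : tr (i + 2) (avg d (T d (i + 2) u i) (T d (i + 2) u (i + 1)) *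
        (incl d (i + 1) u c * (G d (i + 2) u i * incl d (i + 1) u c'))) =
      tr (i + 2) (G d (i + 2) u i * (incl d (i + 1) u c *
        (avg d (T d (i + 2) u i) (T d (i + 2) u (i + 1)) * incl d (i + 1) u c'))) := by
    conv_rhs => rw [avg_comm (T_comm i (i + 1))]
    simp only [avg, mul_smul_comm, smul_mul_assoc, Finset.mul_sum, Finset.sum_mul, map_smul,
      map_sum]
    congr 1
    refine Finset.sum_congr rfl fun s _ => ?_
    have e1 := h.braid (i + 1) i rfl (modPow (T d (i + 1) u i) s * c)
      (modPow (T d (i + 1) u i) (-s) * c')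
    have e2 := h.braid (i + 1) i rfl (modPow (T d (i + 1) u i) s)
      (c * (modPow (T d (i + 1) u i) (-s) * c'))
    rw [← mul_assoc (modPow _ s) c, ← e1] at e2
    rw [← incl_modPow (Nat.lt_add_one i), mul_assoc, modPow_mul_incl, modPow_mul_G_incl]
    simp only [map_mul, mul_assoc] at e2 ⊢
    rw [← e2, ← modPow_mul_incl, ← mul_assoc (G _ _ _ _) (modPow _ _),
      G_mul_modPow_right (by omega), ← incl_modPow (Nat.lt_add_one i)]
    simp only [mul_assoc, incl_modPow (Nat.lt_add_one i)]
  -- In this term each side contains two factors `g_i`, so the bimodule rules do not apply directly;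
  -- cyclicity at the present level moves a framing power around the trace.
  have h3 : tr (i + 2) (avg d (T d (i + 2) u i) (T d (i + 2) u (i + 1)) * G d (i + 2) u i *
        (incl d (i + 1) u c * (G d (i + 2) u i * incl d (i + 1) u c'))) =
      tr (i + 2) (G d (i + 2) u i * (incl d (i + 1) u c *
        (avg d (T d (i + 2) u i) (T d (i + 2) u (i + 1)) * G d (i + 2) u i *
          incl d (i + 1) u c'))) := by
    conv_rhs => rw [avg_comm (T_comm i (i + 1))]
    simp only [avg, mul_smul_comm, smul_mul_assoc, Finset.mul_sum, Finset.sum_mul, map_smul,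
      map_sum]
    congr 1
    refine Finset.sum_congr rfl fun s _ => ?_
    rw [modPow_T_commute]
    simp only [mul_assoc]
    rw [hc, ← mul_assoc (modPow _ s) (G _ _ _ _), ← G_mul_modPow_right (by omega)]
    simp only [mul_assoc]
    rw [modPow_mul_incl, ← mul_assoc (modPow _ s) (G _ _ _ _), ← G_mul_modPow_left (by omega)]
    rw [← (modPow_commute_incl c' (-s)).eq, ← mul_assoc (modPow _ (-s)) (G _ _ _ _),
      ← G_mul_modPow_right (by omega), mul_assoc, mul_assoc,
      ← mul_assoc (modPow _ s) (G _ _ _ _) (_ * _), ← G_mul_modPow_left (by omega), mul_assoc]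
  -- Expanding both squares leaves three terms, with `1`, `e_i` and `e_i g_i`, matched by `h1`, `h2`
  -- and `h3`.
  simp only [relations_Y.quadratic i (show i + 1 < i + 2 by omega), add_mul, mul_add, one_mul,
    smul_mul_assoc, mul_smul_comm, map_add, map_smul, h1, h2, h3]

end Markov

/-! ### Symmetry of `tr(g_n a g_n b)` and the trace property -/

section Markov

variable {d n : ℕ} [NeZero d] {u z : ℂ} {x : ZMod d → ℂ} {tr : (n : ℕ) → Y d n u →ₗ[ℂ] ℂ}

theorem G_mul_G_mul_modPow {i : ℕ} (hi : i + 1 < n) (m : ZMod d) :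
    G d n u i * G d n u i * modPow (T d n u (i + 1)) m =
      modPow (T d n u (i + 1)) m * (G d n u i * G d n u i) := by
  rw [mul_assoc, G_mul_modPow_right hi, ← mul_assoc, G_mul_modPow_left hi, mul_assoc]

/-- Evaluating the inner pair of `g_n` on each side leaves traces on `n + 1` strands. Since
`g_{n-1}^2` commutes with `t_n^m`, both reduce to the same expression, up to cyclicity on `n`
strands. -/
theorem IsMarkov.braid_framing (h : IsMarkov d u z x tr) (hc₀ : ∀ a b : Y d n u,
      tr n (a * b) = tr n (b * a))
    (hc : ∀ a b : Y d (n + 1) u, tr (n + 1) (a * b) = tr (n + 1) (b * a))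
    (a₁ a₂ b₁ b₂ : Y d n u) (m : ZMod d) {i : ℕ} (hi : i + 1 = n) :
    tr (n + 2) (G d (n + 2) u n * incl d (n + 1) u
      (incl d n u a₁ * modPow (T d (n + 1) u n) m * incl d n u a₂) * G d (n + 2) u n *
      incl d (n + 1) u (incl d n u b₁ * G d (n + 1) u i * incl d n u b₂)) =
    tr (n + 2) (G d (n + 2) u n * incl d (n + 1) u
      (incl d n u b₁ * G d (n + 1) u i * incl d n u b₂) * G d (n + 2) u n *
      incl d (n + 1) u (incl d n u a₁ * modPow (T d (n + 1) u n) m * incl d n u a₂)) := by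
  subst hi
  have h1 : ∀ s : ZMod d, tr (i + 2) (incl d (i + 1) u a₁ * modPow (T d (i + 2) u (i + 1)) s *
      incl d (i + 1) u a₂ * (incl d (i + 1) u b₁ * G d (i + 2) u i * incl d (i + 1) u b₂)) =
      z * tr (i + 1) (a₁ * a₂ * b₁ * modPow (T d (i + 1) u i) s * b₂) := fun s => by
    have := h.braid (i + 1) i rfl (a₁ * (a₂ * b₁)) (modPow (T d (i + 1) u i) s * b₂)
    simp only [map_mul, mul_assoc] at this ⊢
    rw [← this]
    simp only [modPow_mul_incl, modPow_mul_G_incl]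
  have h2 := h.braid (i + 1) i rfl (a₁ * a₂ * b₁) b₂
  have h3 : ∀ y, tr (i + 1) (a₁ * a₂ * b₁ * y * b₂) = tr (i + 1) (b₁ * y * (b₂ * a₁ * a₂)) :=
    fun y => by
      rw [mul_assoc, mul_assoc (a₁ * a₂), hc₀]
      simp only [mul_assoc]
  rw [h.trace_G_framing_G, h.trace_G_braid_G _ _ rfl]
  simp only [h1]
  have h4 := h.trace_framing_G_G b₁ (b₂ * a₁ * a₂) m
  have h5 := h3 1
  simp only [mul_one] at h5
  rw [show incl d (i + 1) u a₁ * incl d (i + 1) u a₂ * (incl d (i + 1) u b₁ * G d (i + 2) u i *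
    incl d (i + 1) u b₂) = incl d (i + 1) u (a₁ * a₂ * b₁) * G d (i + 2) u i *
    incl d (i + 1) u b₂ by simp only [map_mul, mul_assoc], h2, h5]
  rw [show incl d (i + 1) u b₁ * (G d (i + 2) u i * G d (i + 2) u i) * incl d (i + 1) u b₂ *
    (incl d (i + 1) u a₁ * modPow (T d (i + 2) u (i + 1)) m * incl d (i + 1) u a₂) =
    incl d (i + 1) u b₁ * (modPow (T d (i + 2) u (i + 1)) m * (G d (i + 2) u i * G d (i + 2) u i)) *
      incl d (i + 1) u (b₂ * a₁ * a₂) by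
    rw [← G_mul_G_mul_modPow (by omega)]
    simp only [map_mul, mul_assoc, modPow_mul_incl], h4]
  simp only [h3, Finset.mul_sum, mul_add]
  congr 1
  · congr 1
    · ring
    · exact Finset.sum_congr rfl fun s _ => by ring
  · ring

/-- Both sides are explicit in the `x`; their sums `∑ x_{m-s} x_{s+l}` and `∑ x_{l-s} x_{s+m}` are
exchanged by `s ↦ -s`. -/
theorem IsMarkov.framing_framing (h : IsMarkov d u z x tr) (hc₀ : ∀ a b : Y d n u,
      tr n (a * b) = tr n (b * a)) (a₁ a₂ b₁ b₂ : Y d n u) (m l : ZMod d) :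
    tr (n + 2) (G d (n + 2) u n * incl d (n + 1) u
      (incl d n u a₁ * modPow (T d (n + 1) u n) m * incl d n u a₂) * G d (n + 2) u n *
      incl d (n + 1) u (incl d n u b₁ * modPow (T d (n + 1) u n) l * incl d n u b₂)) =
    tr (n + 2) (G d (n + 2) u n * incl d (n + 1) u
      (incl d n u b₁ * modPow (T d (n + 1) u n) l * incl d n u b₂) * G d (n + 2) u n *
      incl d (n + 1) u (incl d n u a₁ * modPow (T d (n + 1) u n) m * incl d n u a₂)) := by
  have h1 : ∀ (a₁ a₂ b₁ b₂ : Y d n u) (s l : ZMod d), tr (n + 1) (incl d n u a₁ *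
      modPow (T d (n + 1) u n) s * incl d n u a₂ * (incl d n u b₁ * modPow (T d (n + 1) u n) l *
      incl d n u b₂)) = x (s + l) * tr n (a₁ * a₂ * (b₁ * b₂)) := fun a₁ a₂ b₁ b₂ s l => by
    have := h.framing n (a₁ * (a₂ * b₁)) b₂ (s + l)
    simp only [map_mul, modPow_add T_pow, mul_assoc] at this ⊢
    rw [← this]
    simp only [modPow_mul_incl]
  have h2 : ∀ (a₁ a₂ b₁ b₂ : Y d n u) (l : ZMod d), tr (n + 1) (incl d n u a₁ * incl d n u a₂ *
      (incl d n u b₁ * modPow (T d (n + 1) u n) l * incl d n u b₂)) =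
      x l * tr n (a₁ * a₂ * (b₁ * b₂)) := fun a₁ a₂ b₁ b₂ l => by
    have := h1 a₁ a₂ b₁ b₂ 0 l
    rwa [modPow_zero, mul_one, zero_add] at this
  simp only [h.trace_G_framing_G, h1, h2]
  rw [hc₀ (a₁ * a₂), add_comm l m, ← Equiv.sum_comp (Equiv.neg (ZMod d))]
  congr 2
  · ring
  · congr 1
    refine Finset.sum_congr rfl fun s _ => ?_
    rw [Equiv.neg_apply, sub_neg_eq_add, add_comm m s, neg_add_eq_sub]
    ring

/-- After the common factor `z` is removed, cyclicity turns the claim into `trace_G_G_incl_G` with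
`c = a₂ b₁` and `c' = b₂ a₁`. -/
theorem IsMarkov.braid_braid (h : IsMarkov d u z x tr)
    (hc : ∀ a b : Y d (n + 1) u, tr (n + 1) (a * b) = tr (n + 1) (b * a))
    (a₁ a₂ b₁ b₂ : Y d n u) {i : ℕ} (hi : i + 1 = n) :
    tr (n + 2) (G d (n + 2) u n * incl d (n + 1) u
      (incl d n u a₁ * G d (n + 1) u i * incl d n u a₂) * G d (n + 2) u n *
      incl d (n + 1) u (incl d n u b₁ * G d (n + 1) u i * incl d n u b₂)) =
    tr (n + 2) (G d (n + 2) u n * incl d (n + 1) u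
      (incl d n u b₁ * G d (n + 1) u i * incl d n u b₂) * G d (n + 2) u n *
      incl d (n + 1) u (incl d n u a₁ * G d (n + 1) u i * incl d n u a₂)) := by
  subst hi
  rw [h.trace_G_braid_G _ _ rfl, h.trace_G_braid_G _ _ rfl]
  congr 1
  have := h.trace_G_G_incl_G hc (a₂ * b₁) (b₂ * a₁)
  simp only [map_mul, mul_assoc] at this ⊢
  rw [hc (incl d (i + 1) u a₁), hc (incl d (i + 1) u b₁)]
  simp only [mul_assoc]
  rw [this, ← mul_assoc (G d _ u i) (incl d _ u a₂), ← mul_assoc (G d _ u i * _), hc]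
  simp only [mul_assoc]

/-- By bilinearity, symmetry only needs checking for `a` and `b` of the forms `a₁ t_n^m a₂` and `a₁
g_{n-1} a₂`. -/
theorem IsMarkov.G_comm (h : IsMarkov d u z x tr) (hc₀ : ∀ a b : Y d n u,
      tr n (a * b) = tr n (b * a))
    (hc : ∀ a b : Y d (n + 1) u, tr (n + 1) (a * b) = tr (n + 1) (b * a)) (a b : Y d (n + 1) u) :
    tr (n + 2) (G d (n + 2) u n * incl d (n + 1) u a * G d (n + 2) u n * incl d (n + 1) u b) =
      tr (n + 2) (G d (n + 2) u n * incl d (n + 1) u b * G d (n + 2) u n * incl d (n + 1) u a) := by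
  let B : Y d (n + 1) u →ₗ[ℂ] Y d (n + 1) u →ₗ[ℂ] ℂ := LinearMap.mk₂ ℂ (fun a b =>
    tr (n + 2) (G d (n + 2) u n * incl d (n + 1) u a * G d (n + 2) u n * incl d (n + 1) u b))
    (fun a a' b => by simp only [map_add, mul_add, add_mul])
    (fun c a b => by simp only [map_smul, mul_smul_comm, smul_mul_assoc])
    (fun a b b' => by simp only [map_add, mul_add])
    (fun c a b => by simp only [map_smul, mul_smul_comm])
  have key : B a = B.flip a := by
    refine eq_of_bimodule (φ := B) (ψ := B.flip) (fun a₁ a₂ m => ?_) (fun i hi a₁ a₂ => ?_) a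
    · refine LinearMap.ext fun b => ?_
      exact eq_of_bimodule (φ := B _) (ψ := B.flip _)
        (fun b₁ b₂ l => h.framing_framing hc₀ a₁ a₂ b₁ b₂ m l)
        (fun i hi b₁ b₂ => h.braid_framing hc₀ hc a₁ a₂ b₁ b₂ m hi) b
    · refine LinearMap.ext fun b => ?_
      exact eq_of_bimodule (φ := B _) (ψ := B.flip _)
        (fun b₁ b₂ l => (h.braid_framing hc₀ hc b₁ b₂ a₁ a₂ l hi).symm)
        (fun j hj b₁ b₂ => by
          obtain rfl : j = i := by omega
          exact h.braid_braid hc a₁ a₂ b₁ b₂ hi) b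
  exact LinearMap.congr_fun key b

omit [NeZero d] in
theorem trace_comm_of_generators {τ : Y d n u →ₗ[ℂ] ℂ}
    (hG : ∀ i, i + 1 < n → ∀ y, τ (G d n u i * y) = τ (y * G d n u i))
    (hT : ∀ j, j < n → ∀ y, τ (T d n u j * y) = τ (y * T d n u j)) (a y : Y d n u) :
    τ (a * y) = τ (y * a) := by
  let U : Subalgebra ℂ (Y d n u) :=
    { carrier := {a | ∀ y, τ (a * y) = τ (y * a)}
      mul_mem' := fun {a b} ha hb y => by
        rw [mul_assoc, ha, mul_assoc, hb, mul_assoc]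
      add_mem' := fun {a b} ha hb y => by
        rw [add_mul, mul_add, map_add, map_add, ha, hb]
      algebraMap_mem' := fun r y => by rw [Algebra.commutes] }
  exact mem_subalgebra U hG hT a y

theorem IsMarkov.incl_comm (h : IsMarkov d u z x tr)
    (hc : ∀ a b : Y d n u, tr n (a * b) = tr n (b * a)) (a : Y d n u) (y : Y d (n + 1) u) :
    tr (n + 1) (incl d n u a * y) = tr (n + 1) (y * incl d n u a) := by
  refine eq_of_bimodule (φ := (tr (n + 1)).comp (LinearMap.mulLeft ℂ (incl d n u a)))
    (ψ := (tr (n + 1)).comp (LinearMap.mulRight ℂ (incl d n u a))) (fun b c m => ?_)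
    (fun i hi b c => ?_) y
  · have e1 := h.framing n (a * b) c m
    have e2 := h.framing n b (c * a) m
    rw [mul_assoc a, hc a, mul_assoc b, ← e2] at e1
    simpa only [LinearMap.comp_apply, LinearMap.mulLeft_apply, LinearMap.mulRight_apply, map_mul,
      mul_assoc] using e1
  · have e1 := h.braid n i hi (a * b) c
    have e2 := h.braid n i hi b (c * a)
    rw [mul_assoc a, hc a, mul_assoc b, ← e2] at e1
    simpa only [LinearMap.comp_apply, LinearMap.mulLeft_apply, LinearMap.mulRight_apply, map_mul,
      mul_assoc] using e1

theorem IsMarkov.T_comm_last (h : IsMarkov d u z x tr) (y : Y d (n + 1) u) :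
    tr (n + 1) (T d (n + 1) u n * y) = tr (n + 1) (y * T d (n + 1) u n) := by
  refine eq_of_bimodule (φ := (tr (n + 1)).comp (LinearMap.mulLeft ℂ (T d (n + 1) u n)))
    (ψ := (tr (n + 1)).comp (LinearMap.mulRight ℂ (T d (n + 1) u n))) (fun b c m => ?_)
    (fun i hi b c => ?_) y
  · simp only [LinearMap.comp_apply, LinearMap.mulLeft_apply, LinearMap.mulRight_apply]
    rw [((T_commute_incl b).mul_right (commute_modPow_right (Commute.refl _) m)).mul_right
      (T_commute_incl c)]
  · subst hi
    have e1 := h.braid (i + 1) i rfl b (T d (i + 1) u i * c)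
    have e2 := h.braid (i + 1) i rfl (b * T d (i + 1) u i) c
    have l1 : T d (i + 2) u (i + 1) * (incl d _ u b * G d _ u i * incl d _ u c) =
        incl d _ u b * G d _ u i * incl d _ u (T d (i + 1) u i * c) := by
      rw [map_mul, incl_T (Nat.lt_add_one i), ← mul_assoc, ← mul_assoc, (T_commute_incl b).eq,
        mul_assoc (incl _ _ _ b), relations_Y.right i (by omega)]
      simp only [mul_assoc]
    have l2 : incl d _ u b * G d _ u i * incl d _ u c * T d (i + 2) u (i + 1) =
        incl d _ u (b * T d (i + 1) u i) * G d _ u i * incl d _ u c := by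
      rw [map_mul, incl_T (Nat.lt_add_one i), mul_assoc _ _ (T _ _ _ _), ← (T_commute_incl c).eq,
        mul_assoc (incl _ _ _ b) (T _ _ _ _), relations_Y.left i (by omega)]
      simp only [mul_assoc]
    rw [mul_assoc b, ← e1] at e2
    simp only [LinearMap.comp_apply, LinearMap.mulLeft_apply, LinearMap.mulRight_apply]
    exact (congrArg _ l1).trans (e2.symm.trans (congrArg _ l2.symm))

/-- It suffices to commute generators past everything. The step for `g_n` uses `G_comm`, which needs
cyclicity on the two preceding levels; hence the paired induction. -/
theorem IsMarkov.comm (h : IsMarkov d u z x tr) (n : ℕ) (a b : Y d n u) :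
    tr n (a * b) = tr n (b * a) := by
  suffices H : ∀ n, (∀ a b : Y d n u, tr n (a * b) = tr n (b * a)) ∧
      ∀ a b : Y d (n + 1) u, tr (n + 1) (a * b) = tr (n + 1) (b * a) from (H n).1 a b
  have hTn : ∀ n, (∀ a b : Y d n u, tr n (a * b) = tr n (b * a)) → ∀ j, j < n + 1 → ∀ y,
      tr (n + 1) (T d (n + 1) u j * y) = tr (n + 1) (y * T d (n + 1) u j) := fun n hc j hj y => by
    rcases Nat.lt_succ_iff_lt_or_eq.1 hj with hj | rfl
    · rw [← incl_T hj]; exact h.incl_comm hc _ y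
    · exact h.T_comm_last y
  intro n
  induction n with
  | zero =>
    have h0 : ∀ a b : Y d 0 u, tr 0 (a * b) = tr 0 (b * a) :=
      trace_comm_of_generators (fun i hi => by omega) (fun i hi => by omega)
    exact ⟨h0, trace_comm_of_generators (fun i hi => by omega) (hTn 0 h0)⟩
  | succ n ih =>
    refine ⟨ih.2, trace_comm_of_generators (fun i hi y => ?_) (hTn _ ih.2)⟩
    by_cases hin : i < n
    · rw [← incl_G (by omega)]; exact h.incl_comm ih.2 _ y
    obtain rfl : i = n := by omega
    refine eq_of_bimodule (φ := (tr (i + 2)).comp (LinearMap.mulLeft ℂ (G d (i + 2) u i)))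
      (ψ := (tr (i + 2)).comp (LinearMap.mulRight ℂ (G d (i + 2) u i))) (fun b c m => ?_)
      (fun j hj b c => ?_) y
    · simp only [LinearMap.comp_apply, LinearMap.mulLeft_apply, LinearMap.mulRight_apply]
      have e1 := h.braid (i + 1) i rfl (modPow (T d (i + 1) u i) m) (b * c)
      have e2 := h.braid (i + 1) i rfl (b * c) (modPow (T d (i + 1) u i) m)
      rw [ih.2, ← e2] at e1
      have l1 : G d (i + 2) u i * (incl d _ u b * modPow (T d _ u (i + 1)) m * incl d _ u c) =
          incl d _ u (modPow (T d (i + 1) u i) m) * G d _ u i * incl d _ u (b * c) := by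
        rw [← (modPow_commute_incl b m).eq, ← mul_assoc, ← mul_assoc,
          G_mul_modPow_right (by omega), incl_modPow (Nat.lt_add_one i), map_mul, ← mul_assoc]
      have l2 : incl d _ u b * modPow (T d _ u (i + 1)) m * incl d _ u c * G d (i + 2) u i =
          incl d _ u (b * c) * G d _ u i * incl d _ u (modPow (T d (i + 1) u i) m) := by
        rw [mul_assoc (incl _ _ _ b), (modPow_commute_incl c m).eq, mul_assoc, mul_assoc,
          ← G_mul_modPow_left (by omega), incl_modPow (Nat.lt_add_one i), map_mul]
        simp only [mul_assoc]
      exact (congrArg _ l1).trans (e1.trans (congrArg _ l2.symm))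
    · obtain rfl : j = i := by omega
      simp only [LinearMap.comp_apply, LinearMap.mulLeft_apply, LinearMap.mulRight_apply]
      -- Symmetry turns `tr(g b g c)` into `tr(g c g b)`, and `b`, on one strand fewer, may be moved
      -- to the front.
      rw [← mul_assoc, ← mul_assoc, h.G_comm ih.1 ih.2, ← h.incl_comm ih.2]
      simp only [mul_assoc]

end Markov

/-! ### Existence and uniqueness of the Juyumaya trace -/

section ExistsUnique

variable {d n : ℕ} [NeZero d] {u z : ℂ} {x : ZMod d → ℂ} {tr : (n : ℕ) → Y d n u →ₗ[ℂ] ℂ}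

omit [NeZero d] in
theorem IsMarkov.compat (h : IsMarkov d u z x tr) (hx : x 0 = 1) (n : ℕ) (a : Y d n u) :
    tr (n + 1) (incl d n u a) = tr n a := by
  simpa [modPow_zero, hx] using h.framing n a 1 0

omit [NeZero d] in
theorem IsMarkov.map_one (h : IsMarkov d u z x tr) (hx : x 0 = 1) (n : ℕ) : tr n 1 = 1 := by
  induction n with
  | zero => exact h.one
  | succ n ih => rw [← ih, ← h.compat hx n 1, _root_.map_one (incl d n u)]

theorem IsMarkov.isJuyumayaTrace (h : IsMarkov d u z x tr) (hx : x 0 = 1) :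
    IsJuyumayaTrace d u z x tr where
  compat := h.compat hx
  map_one := h.map_one hx
  map_mul_comm := h.comm
  markov n a := by
    have := h.braid (n + 1) n rfl a 1
    rw [_root_.map_one, mul_one, mul_one] at this
    rw [← this, G_of_lt]
  framing n a m _ _ := by
    have := h.framing n a 1 (m : ZMod d)
    rw [_root_.map_one, mul_one, mul_one, modPow_natCast T_pow] at this
    rw [← this, T_of_lt (Nat.lt_add_one n)]
    rfl

theorem IsJuyumayaTrace.isMarkov (h : IsJuyumayaTrace d u z x tr) (hx : x 0 = 1) :
    IsMarkov d u z x tr where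
  one := h.map_one 0
  framing n a b m := by
    rw [h.map_mul_comm, ← mul_assoc, ← _root_.map_mul, h.map_mul_comm n a b]
    -- The framing axiom covers only `1 ≤ m ≤ d - 1`; exponent `0` is compatibility together with `x
    -- 0 = 1`.
    rcases eq_or_ne m 0 with rfl | hm
    · rw [modPow_zero, mul_one, h.compat, hx, one_mul]
    · have := h.framing n (b * a) m.val
        (Nat.one_le_iff_ne_zero.2 ((ZMod.val_ne_zero m).2 hm)) (Nat.le_sub_one_of_lt (ZMod.val_lt m))
      rw [ZMod.natCast_zmod_val] at this
      rw [← this, modPow, T_of_lt (Nat.lt_add_one n)]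
      rfl
  braid n i hi a b := by
    subst hi
    rw [h.map_mul_comm, ← mul_assoc, ← _root_.map_mul, h.map_mul_comm (i + 1) a b, ← h.markov,
      G_of_lt (show i + 1 < i + 1 + 1 by omega)]

theorem IsMarkov.unique {tr' : (n : ℕ) → Y d n u →ₗ[ℂ] ℂ} (h : IsMarkov d u z x tr)
    (h' : IsMarkov d u z x tr') : tr = tr' := by
  funext n
  induction n with
  | zero => exact LinearMap.ext (eq_of_zero (h.one.trans h'.one.symm))
  | succ n ih =>
    exact LinearMap.ext (eq_of_bimodule
      (fun a b m => by rw [h.framing, h'.framing, ih])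
      (fun i hi a b => by rw [h.braid n i hi, h'.braid n i hi, ih]))

theorem existsUnique_isJuyumayaTrace (u z : ℂ) (hx : x 0 = 1) :
    ∃! tr : (k : ℕ) → Y d k u →ₗ[ℂ] ℂ, IsJuyumayaTrace d u z x tr :=
  ⟨juyumayaTrace d u z x, (isMarkov_juyumayaTrace d u z x).isJuyumayaTrace hx,
    fun _ h => (h.isMarkov hx).unique (isMarkov_juyumayaTrace d u z x)⟩

end ExistsUnique

/-! ### Passing to the quotient -/

section Quotient

variable {d n : ℕ} {u : ℂ}

theorem toYTL_surjective (d n : ℕ) (u : ℂ) : Function.Surjective (toYTL d n u) := by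
  intro y
  obtain ⟨a, rfl⟩ := RingCon.mk'_surjective (ytlIdeal d n u).ringCon y
  exact ⟨a, rfl⟩

theorem toYTL_eq_zero_iff {a : Y d n u} : toYTL d n u a = 0 ↔ a ∈ ytlIdeal d n u := by
  rw [TwoSidedIdeal.mem_iff]
  exact (ytlIdeal d n u).ringCon.eq

theorem passesToYTL_iff_ker {τ : Y d n u →ₗ[ℂ] ℂ} :
    PassesToYTL d n u τ ↔ ∀ a ∈ ytlIdeal d n u, τ a = 0 := by
  constructor
  · rintro ⟨φ, rfl⟩ a ha
    rw [LinearMap.comp_apply, AlgHom.toLinearMap_apply, toYTL_eq_zero_iff.2 ha, map_zero]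
  · intro h
    have hker : LinearMap.ker (toYTL d n u).toLinearMap ≤ LinearMap.ker τ := fun a ha =>
      h a (toYTL_eq_zero_iff.1 ha)
    refine ⟨(Submodule.liftQ _ τ hker).comp ((toYTL d n u).toLinearMap.quotKerEquivOfSurjective
      (toYTL_surjective d n u)).symm.toLinearMap, LinearMap.ext fun a => ?_⟩
    have : ((toYTL d n u).toLinearMap.quotKerEquivOfSurjective (toYTL_surjective d n u)).symm
        ((toYTL d n u).toLinearMap a) = Submodule.Quotient.mk a := by
      rw [LinearEquiv.symm_apply_eq]; rfl
    simp only [LinearMap.comp_apply, LinearEquiv.coe_coe]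
    rw [this]
    rfl

theorem passesToYTL_iff {τ : Y d n u →ₗ[ℂ] ℂ} (hτ : ∀ a b, τ (a * b) = τ (b * a)) :
    PassesToYTL d n u τ ↔ ∀ (i : ℕ) (hi : i + 2 < n) (y : Y d n u),
      τ (y * steinberg d u i hi) = 0 := by
  rw [passesToYTL_iff_ker]
  constructor
  · intro h i hi y
    exact h _ ((ytlIdeal d n u).mul_mem_left _ _ (TwoSidedIdeal.subset_span ⟨i, hi, rfl⟩))
  · intro h a ha
    -- The left radical of `(y, a) ↦ τ (y a)` is a two-sided ideal because `τ` is cyclic, so it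
    -- contains the ideal as soon as it contains the generators.
    let I : TwoSidedIdeal (Y d n u) := TwoSidedIdeal.mk' {a | ∀ y, τ (y * a) = 0}
      (fun y => by simp) (fun {a b} ha hb y => by rw [mul_add, map_add, ha, hb, add_zero])
      (fun {a} ha y => (congrArg τ (mul_neg y a)).trans ((map_neg τ _).trans (by rw [ha, neg_zero])))
      (fun {a b} hb y => by rw [← mul_assoc]; exact hb _)
      (fun {a b} ha y => by rw [← mul_assoc, hτ, ← mul_assoc]; exact ha _)
    have hI : ytlIdeal d n u ≤ I := by
      refine TwoSidedIdeal.span_le.2 ?_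
      rintro _ ⟨i, hi, rfl⟩
      exact (TwoSidedIdeal.mem_mk' _ _ _ _ _ _ _).2 (h i hi)
    have := (TwoSidedIdeal.mem_mk' _ _ _ _ _ _ _).1 (hI ha) 1
    rwa [one_mul] at this

/-- The element `g_{i,i+1}` in terms of the sequence of braiding generators. -/
def steinbergSeq (d n : ℕ) (u : ℂ) (i : ℕ) : Y d n u :=
  G d n u i * G d n u (i + 1) * G d n u i + G d n u (i + 1) * G d n u i +
    G d n u i * G d n u (i + 1) + G d n u i + G d n u (i + 1) + 1

theorem steinberg_eq {i : ℕ} (hi : i + 2 < n) : steinberg d u i hi = steinbergSeq d n u i := by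
  rw [steinbergSeq, G_of_lt (show i + 1 < n by omega), G_of_lt (show i + 1 + 1 < n by omega)]
  rfl

theorem incl_steinbergSeq {i : ℕ} (hi : i + 2 < n) :
    incl d n u (steinbergSeq d n u i) = steinbergSeq d (n + 1) u i := by
  simp only [steinbergSeq, map_add, map_mul, map_one, incl_G (show i + 1 < n by omega),
    incl_G (show i + 1 + 1 < n by omega)]

variable [NeZero d]

theorem G_mul_one_add_G {i : ℕ} (hi : i + 1 < n) : G d n u i * (1 + G d n u i) =
    (1 + (u - 1) • avg d (T d n u i) (T d n u (i + 1))) * (1 + G d n u i) := by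
  rw [mul_add, relations_Y.quadratic i hi, mul_one, add_mul, one_mul, smul_mul_assoc, mul_add,
    mul_one, smul_add]
  abel

/-- The factor `1 + g_i` splits off on the left, and `g_i` acts on it through a framing element. By
the braid relation, `1 + g_{i+1}` also splits off, which gives the next lemma. -/
theorem G_mul_steinbergSeq_left {i : ℕ} (hi : i + 1 < n) : G d n u i * steinbergSeq d n u i =
    (1 + (u - 1) • avg d (T d n u i) (T d n u (i + 1))) * steinbergSeq d n u i := by
  have : steinbergSeq d n u i = (1 + G d n u i) *
      (1 + G d n u (i + 1) + G d n u (i + 1) * G d n u i) := by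
    simp only [steinbergSeq, mul_add, add_mul, one_mul, mul_one, ← mul_assoc]; abel
  rw [this, ← mul_assoc, G_mul_one_add_G hi, ← mul_assoc]

theorem G_mul_steinbergSeq_right {i : ℕ} (hi : i + 2 < n) :
    G d n u (i + 1) * steinbergSeq d n u i =
    (1 + (u - 1) • avg d (T d n u (i + 1)) (T d n u (i + 1 + 1))) * steinbergSeq d n u i := by
  have : steinbergSeq d n u i = (1 + G d n u (i + 1)) *
      (1 + G d n u i + G d n u i * G d n u (i + 1)) := by
    rw [steinbergSeq, relations_Y.braid i hi]
    simp only [mul_add, add_mul, one_mul, mul_one, ← mul_assoc]; abel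
  rw [this, ← mul_assoc, G_mul_one_add_G hi, ← mul_assoc]

theorem exists_G_mul_eq_one (hu : u ≠ 0) {i : ℕ} (hi : i + 1 < n) :
    ∃ w : Y d n u, G d n u i * w = 1 := by
  set e := avg d (T d n u i) (T d n u (i + 1)) with he
  have hee : e * e = e := avg_mul_avg T_pow T_pow (T_comm _ _)
  -- The quadratic relation gives `g_i (g_i - (u-1)e) = 1 + (u-1)e`; as `e` is idempotent, this is
  -- inverted by `1 + (u⁻¹ - 1)e`.
  refine ⟨(G d n u i - (u - 1) • e) * (1 + (u⁻¹ - 1) • e), ?_⟩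
  rw [← mul_assoc, mul_sub, relations_Y.quadratic i hi, mul_smul_comm, ← avg_mul_G hi, ← he,
    add_sub_cancel_right, add_mul, one_mul, smul_mul_assoc, mul_add, mul_one, mul_smul_comm, hee,
    smul_add, smul_smul]
  have : (u⁻¹ - 1) + ((u - 1) + (u - 1) * (u⁻¹ - 1)) = 0 := by field_simp; ring
  rw [add_assoc, ← add_smul, ← add_smul, this, zero_smul, add_zero]

/-- In the braid group `σ_i σ_{i+1} σ_{i+2}` conjugates `σ_i` to `σ_{i+1}` and `σ_{i+1}` to
`σ_{i+2}`. -/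
theorem semiconj_steinbergSeq {i : ℕ} (hi : i + 3 < n) :
    SemiconjBy (G d n u i * G d n u (i + 1) * G d n u (i + 1 + 1)) (steinbergSeq d n u i)
      (steinbergSeq d n u (i + 1)) := by
  have h1 : SemiconjBy (G d n u i * G d n u (i + 1) * G d n u (i + 1 + 1)) (G d n u i)
      (G d n u (i + 1)) := by
    rw [SemiconjBy, mul_assoc, ← relations_Y.far i (i + 1 + 1) (by omega) (by omega), ← mul_assoc,
      relations_Y.braid i (by omega)]
    simp only [mul_assoc]
  have h2 : SemiconjBy (G d n u i * G d n u (i + 1) * G d n u (i + 1 + 1)) (G d n u (i + 1))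
      (G d n u (i + 1 + 1)) := by
    rw [SemiconjBy, mul_assoc, mul_assoc, ← mul_assoc (G d n u (i + 1)),
      relations_Y.braid (i + 1) (by omega), ← mul_assoc, ← mul_assoc,
      relations_Y.far i (i + 1 + 1) (by omega) (by omega)]
    simp only [mul_assoc]
  exact ((((((h1.mul_right h2).mul_right h1).add_right (h2.mul_right h1)).add_right
    (h1.mul_right h2)).add_right h1).add_right h2).add_right (SemiconjBy.one_right _)

end Quotient

/-! ### The trace on the ideal -/

section Vanishing

variable {d n : ℕ} [NeZero d] {u z : ℂ} {x : ZMod d → ℂ} {tr : (n : ℕ) → Y d n u →ₗ[ℂ] ℂ}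

/-- The trace of `t_0^a t_1^b t_2^c g_{0,1}`. -/
def steinbergTrace {d : ℕ} [NeZero d] (u z : ℂ) (x : ZMod d → ℂ) (a b c : ZMod d) : ℂ :=
  x a * x b * x c + z * x (a + b) * x c + z * x a * x (b + c) + 2 * z ^ 2 * x (a + b + c) +
    z * (x b * x (a + c) + ((u - 1) * (1 / (d : ℂ))) * ∑ s : ZMod d, x (b - s) * x (a + c + s) +
      (u - 1) * z * x (a + b + c))

/-- The monomial `t_0^a t_1^b t_2^c`. -/
def framMon (d n : ℕ) (u : ℂ) (a b c : ZMod d) : Y d n u :=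
  modPow (T d n u 0) a * modPow (T d n u 1) b * modPow (T d n u 2) c

/-- Each of the six terms is evaluated by pushing `t_2^c` through the braiding generators until the
top strand can be removed. Only `g_0 g_1 g_0` leaves a square `g_0^2`, the source of the terms with
`u - 1`. -/
theorem IsMarkov.trace_framMon_steinbergSeq (h : IsMarkov d u z x tr)
    (a b c : ZMod d) :
    tr 3 (framMon d 3 u a b c * steinbergSeq d 3 u 0) = steinbergTrace u z x a b c := by
  have t1 : ∀ a : ZMod d, tr 1 (modPow (T d 1 u 0) a) = x a := fun a => by
    have := h.framing 0 1 1 a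
    rwa [_root_.map_one, one_mul, mul_one, mul_one, h.one, mul_one] at this
  have t2 : ∀ a b : ZMod d, tr 2 (modPow (T d 2 u 0) a * modPow (T d 2 u 1) b) = x b * x a :=
    fun a b => by
      have := h.framing 1 (modPow (T d 1 u 0) a) 1 b
      rwa [_root_.map_one, mul_one, mul_one, t1, incl_modPow (by omega)] at this
  have t2g : ∀ a b : ZMod d, tr 2 (modPow (T d 2 u 0) a * modPow (T d 2 u 1) b * G d 2 u 0) =
      z * x (a + b) := fun a b => by
    have := h.braid 1 0 rfl (modPow (T d 1 u 0) a) (modPow (T d 1 u 0) b)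
    rw [← modPow_add T_pow, t1, incl_modPow (by omega), incl_modPow (by omega), mul_assoc,
      G_mul_modPow_left (by omega), ← mul_assoc] at this
    exact this
  have i2 : ∀ a b : ZMod d, incl d 2 u (modPow (T d 2 u 0) a * modPow (T d 2 u 1) b) =
      modPow (T d 3 u 0) a * modPow (T d 3 u 1) b := fun a b => by
    rw [_root_.map_mul, incl_modPow (by omega), incl_modPow (by omega)]
  have iG : incl d 2 u (G d 2 u 0) = G d 3 u 0 := incl_G (by omega)
  have e1 : tr 3 (framMon d 3 u a b c) = x a * x b * x c := by
    have := h.framing 2 (modPow (T d 2 u 0) a * modPow (T d 2 u 1) b) 1 c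
    rw [_root_.map_one, mul_one, mul_one, t2, i2] at this
    exact this.trans (by ring)
  have e2 : tr 3 (framMon d 3 u a b c * G d 3 u 0) = z * x (a + b) * x c := by
    have := h.framing 2 (modPow (T d 2 u 0) a * modPow (T d 2 u 1) b) (G d 2 u 0) c
    rw [t2g, i2, iG] at this
    exact this.trans (by ring)
  have hT2 : modPow (T d 3 u 2) c * G d 3 u 1 = G d 3 u 1 * modPow (T d 3 u 1) c :=
    (G_mul_modPow_left (by omega) c).symm
  have hT2' : modPow (T d 3 u 2) c * G d 3 u 0 = G d 3 u 0 * modPow (T d 3 u 2) c :=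
    Commute.pow_left (relations_Y.other 0 2 (by omega) (by omega) (by omega) (by omega)) _
  have i1 : ∀ c : ZMod d, incl d 2 u (modPow (T d 2 u 1) c) = modPow (T d 3 u 1) c :=
    fun c => incl_modPow (by omega) c
  have e3 : tr 3 (framMon d 3 u a b c * G d 3 u 1) = z * x a * x (b + c) := by
    have := h.braid 2 1 rfl (modPow (T d 2 u 0) a * modPow (T d 2 u 1) b) (modPow (T d 2 u 1) c)
    rw [mul_assoc (modPow _ a), ← modPow_add T_pow, t2, i2, i1] at this
    rw [framMon, mul_assoc, hT2, ← mul_assoc]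
    exact this.trans (by ring)
  have hG1 : G d 2 u 0 * modPow (T d 2 u 1) c = modPow (T d 2 u 0) c * G d 2 u 0 :=
    G_mul_modPow_right (by omega) c
  have hacb : ∀ b : ZMod d, modPow (T d 2 u 0) a * modPow (T d 2 u 1) b * modPow (T d 2 u 0) c =
      modPow (T d 2 u 0) (a + c) * modPow (T d 2 u 1) b := fun b => by
    rw [mul_assoc, modPow_T_commute, ← mul_assoc, ← modPow_add T_pow]
  have e4 : tr 3 (framMon d 3 u a b c * (G d 3 u 0 * G d 3 u 1)) = z ^ 2 * x (a + b + c) := by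
    have := h.braid 2 1 rfl (modPow (T d 2 u 0) a * modPow (T d 2 u 1) b * G d 2 u 0)
      (modPow (T d 2 u 1) c)
    rw [mul_assoc _ (G d 2 u 0), hG1, ← mul_assoc, hacb, t2g, _root_.map_mul (incl d 2 u), i2, i1, iG] at this
    rw [framMon, mul_assoc, ← mul_assoc _ (G d 3 u 0), hT2', mul_assoc (G d 3 u 0), hT2]
    simp only [← mul_assoc]
    exact this.trans (by rw [add_right_comm]; ring)
  have e5 : tr 3 (framMon d 3 u a b c * (G d 3 u 1 * G d 3 u 0)) = z ^ 2 * x (a + b + c) := by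
    have := h.braid 2 1 rfl (modPow (T d 2 u 0) a * modPow (T d 2 u 1) b)
      (modPow (T d 2 u 1) c * G d 2 u 0)
    rw [← mul_assoc, mul_assoc (modPow _ a), ← modPow_add T_pow, t2g, i2, _root_.map_mul (incl d 2 u), i1, iG,
      ← add_assoc] at this
    rw [framMon, mul_assoc, ← mul_assoc _ (G d 3 u 1), hT2, ← mul_assoc, ← mul_assoc]
    rw [← mul_assoc] at this
    exact this.trans (by ring)
  have e6 : tr 3 (framMon d 3 u a b c * (G d 3 u 0 * G d 3 u 1 * G d 3 u 0)) =
      z * (x b * x (a + c) + ((u - 1) * (1 / (d : ℂ))) * ∑ s : ZMod d, x (b - s) * x (a + c + s) +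
      (u - 1) * z * x (a + b + c)) := by
    have := h.braid 2 1 rfl (modPow (T d 2 u 0) a * modPow (T d 2 u 1) b * G d 2 u 0)
      (modPow (T d 2 u 1) c * G d 2 u 0)
    have hq := h.trace_framing_G_G (modPow (T d 1 u 0) (a + c)) 1 b
    simp only [_root_.map_one, mul_one, ← modPow_add T_pow, t1] at hq
    rw [incl_modPow (by omega)] at hq
    have hq' : tr 2 (modPow (T d 2 u 0) (a + c) * modPow (T d 2 u 1) b * G d 2 u 0 * G d 2 u 0) =
        x b * x (a + c) + ((u - 1) * (1 / (d : ℂ))) * ∑ s : ZMod d, x (b - s) * x (a + c + s) +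
          (u - 1) * z * x (a + c + b) := by
      rw [mul_assoc, mul_assoc]
      exact hq
    rw [mul_assoc _ (G d 2 u 0), ← mul_assoc (G d 2 u 0), hG1, ← mul_assoc, ← mul_assoc, hacb,
      hq', _root_.map_mul (incl d 2 u) (_ * _), i2, _root_.map_mul (incl d 2 u), i1, iG] at this
    rw [framMon, mul_assoc, mul_assoc (G d 3 u 0), ← mul_assoc (modPow _ c) (G d 3 u 0), hT2',
      mul_assoc (G d 3 u 0), ← mul_assoc (modPow _ c) (G d 3 u 1), hT2]
    simp only [← mul_assoc] at this ⊢
    exact this.trans (by rw [add_right_comm a c b])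
  simp only [steinbergSeq, mul_add, mul_one, map_add, zero_add, e1, e2, e3, e4, e5, e6]
  rw [steinbergTrace]
  ring

end Vanishing

/-! ### Reduction of the ideal to framing monomials on three strands -/

section Vanishing

variable {d n : ℕ} [NeZero d] {u z : ℂ} {x : ZMod d → ℂ} {tr : (n : ℕ) → Y d n u →ₗ[ℂ] ℂ}

/-- The span of the elements `t_0^a t_1^b t_2^c g_{0,1}` of `Y_{d,3}(u)`. -/
def framSpan (d : ℕ) (u : ℂ) : Submodule ℂ (Y d 3 u) :=
  Submodule.span ℂ {y | ∃ a b c : ZMod d, y = framMon d 3 u a b c * steinbergSeq d 3 u 0}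

omit [NeZero d] in
theorem framMon_mem (a b c : ZMod d) :
    framMon d 3 u a b c * steinbergSeq d 3 u 0 ∈ framSpan d u :=
  Submodule.subset_span ⟨a, b, c, rfl⟩

theorem modPow_mul_framMon (j : ℕ) (hj : j < 3) (s a b c : ZMod d) :
    ∃ a' b' c', modPow (T d 3 u j) s * framMon d 3 u a b c = framMon d 3 u a' b' c' := by
  interval_cases j
  · exact ⟨s + a, b, c, by simp only [framMon, modPow_add T_pow, mul_assoc]⟩
  · refine ⟨a, s + b, c, ?_⟩
    simp only [framMon, modPow_add T_pow, ← mul_assoc]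
    rw [modPow_T_commute 1 0]
  · refine ⟨a, b, s + c, ?_⟩
    simp only [framMon, modPow_add T_pow, ← mul_assoc]
    rw [modPow_T_commute 2 0, mul_assoc _ _ (modPow (T d 3 u 1) b), modPow_T_commute 2 1,
      ← mul_assoc]

theorem modPow_mul_mem_framSpan (j : ℕ) (hj : j < 3) (s : ZMod d) {y : Y d 3 u}
    (hy : y ∈ framSpan d u) : modPow (T d 3 u j) s * y ∈ framSpan d u := by
  have : framSpan d u ≤ (framSpan d u).comap (LinearMap.mulLeft ℂ (modPow (T d 3 u j) s)) := by
    refine Submodule.span_le.2 ?_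
    rintro _ ⟨a, b, c, rfl⟩
    obtain ⟨a', b', c', h⟩ := modPow_mul_framMon (u := u) j hj s a b c
    rw [SetLike.mem_coe, Submodule.mem_comap, LinearMap.mulLeft_apply, ← mul_assoc, h]
    exact framMon_mem _ _ _
  exact this hy

theorem one_add_avg_mul_mem_framSpan {i : ℕ} (hi : i + 1 < 3) {y : Y d 3 u}
    (hy : y ∈ framSpan d u) :
    (1 + (u - 1) • avg d (T d 3 u i) (T d 3 u (i + 1))) * y ∈ framSpan d u := by
  rw [add_mul, one_mul, smul_mul_assoc, avg, smul_mul_assoc, Finset.sum_mul]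
  refine Submodule.add_mem _ hy (Submodule.smul_mem _ _ (Submodule.smul_mem _ _
    (Submodule.sum_mem _ fun s _ => ?_)))
  rw [mul_assoc]
  exact modPow_mul_mem_framSpan _ (by omega) _ (modPow_mul_mem_framSpan _ (by omega) _ hy)

theorem G_zero_mul_framMon (a b c : ZMod d) :
    G d 3 u 0 * framMon d 3 u a b c = framMon d 3 u b a c * G d 3 u 0 := by
  have h2 : G d 3 u 0 * modPow (T d 3 u 2) c = modPow (T d 3 u 2) c * G d 3 u 0 :=
    (Commute.pow_left (relations_Y.other 0 2 (by omega) (by omega) (by omega) (by omega)) _).symm.eq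
  have h0 : G d 3 u 0 * modPow (T d 3 u 0) a = modPow (T d 3 u 1) a * G d 3 u 0 :=
    G_mul_modPow_left (by omega) a
  have h1 : G d 3 u 0 * modPow (T d 3 u 1) b = modPow (T d 3 u 0) b * G d 3 u 0 :=
    G_mul_modPow_right (by omega) b
  rw [framMon, ← mul_assoc, ← mul_assoc, h0, mul_assoc _ (G d 3 u 0), h1, mul_assoc,
    mul_assoc _ (G d 3 u 0), h2, ← mul_assoc, ← mul_assoc, modPow_T_commute 1 0, framMon]

theorem G_one_mul_framMon (a b c : ZMod d) :
    G d 3 u 1 * framMon d 3 u a b c = framMon d 3 u a c b * G d 3 u 1 := by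
  have h0 : G d 3 u 1 * modPow (T d 3 u 0) a = modPow (T d 3 u 0) a * G d 3 u 1 :=
    (Commute.pow_left (relations_Y.other 1 0 (by omega) (by omega) (by omega) (by omega)) _).symm.eq
  have h1 : G d 3 u 1 * modPow (T d 3 u 1) b = modPow (T d 3 u 2) b * G d 3 u 1 :=
    G_mul_modPow_left (by omega) b
  have h2 : G d 3 u 1 * modPow (T d 3 u 2) c = modPow (T d 3 u 1) c * G d 3 u 1 :=
    G_mul_modPow_right (by omega) c
  rw [framMon, ← mul_assoc, ← mul_assoc, h0, mul_assoc _ (G d 3 u 1), h1, mul_assoc, mul_assoc,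
    h2, ← mul_assoc (modPow _ b), modPow_T_commute 2 1, framMon]
  simp only [mul_assoc]

/-- A braiding generator permutes the exponents of the monomial and is then absorbed by `g_{0,1}` at
the cost of a framing element. -/
theorem G_mul_mem_framSpan {i : ℕ} (hi : i + 1 < 3) {y : Y d 3 u} (hy : y ∈ framSpan d u) :
    G d 3 u i * y ∈ framSpan d u := by
  have hmul : ∀ (a b c : ZMod d) (w : Y d 3 u), w ∈ framSpan d u →
      framMon d 3 u a b c * w ∈ framSpan d u := fun a b c w hw => by
    rw [framMon, mul_assoc, mul_assoc]
    exact modPow_mul_mem_framSpan _ (by omega) _ (modPow_mul_mem_framSpan _ (by omega) _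
      (modPow_mul_mem_framSpan _ (by omega) _ hw))
  have hS : steinbergSeq d 3 u 0 ∈ framSpan d u := by
    simpa [framMon, modPow_zero] using framMon_mem (u := u) (0 : ZMod d) 0 0
  have : framSpan d u ≤ (framSpan d u).comap (LinearMap.mulLeft ℂ (G d 3 u i)) := by
    refine Submodule.span_le.2 ?_
    rintro _ ⟨a, b, c, rfl⟩
    rw [SetLike.mem_coe, Submodule.mem_comap, LinearMap.mulLeft_apply, ← mul_assoc]
    have hi' : i < 2 := by omega
    interval_cases i
    · rw [G_zero_mul_framMon, mul_assoc, G_mul_steinbergSeq_left (by omega)]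
      exact hmul _ _ _ _ (one_add_avg_mul_mem_framSpan hi hS)
    · rw [G_one_mul_framMon, mul_assoc]
      have := G_mul_steinbergSeq_right (d := d) (n := 3) (u := u) (i := 0) (by omega)
      rw [zero_add] at this
      rw [this]
      exact hmul _ _ _ _ (one_add_avg_mul_mem_framSpan hi hS)
  exact this hy

theorem mul_steinbergSeq_mem_framSpan (y : Y d 3 u) : y * steinbergSeq d 3 u 0 ∈ framSpan d u := by
  refine mem_of_left_mul
    ((framSpan d u).comap (LinearMap.mulRight ℂ (steinbergSeq d 3 u 0))) ?_ (fun i hi w hw => ?_)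
    (fun j hj w hw => ?_) y
  · simpa [framMon, modPow_zero] using framMon_mem (u := u) (0 : ZMod d) 0 0
  · rw [Submodule.mem_comap, LinearMap.mulRight_apply, mul_assoc]
    exact G_mul_mem_framSpan hi hw
  · rw [Submodule.mem_comap, LinearMap.mulRight_apply, mul_assoc]
    have := modPow_mul_mem_framSpan (u := u) j hj (1 : ZMod d) hw
    rwa [modPow_one T_pow] at this

/-- Adding a strand, the Markov rules reduce the old elements `g_{i,i+1}` to fewer strands, and the
new one is conjugate to its predecessor. -/
theorem IsMarkov.trace_mul_steinbergSeq (h : IsMarkov d u z x tr) (hu : u ≠ 0)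
    (hT : ∀ a b c : ZMod d, steinbergTrace u z x a b c = 0) (k : ℕ) :
    ∀ i, i < k + 1 → ∀ y : Y d (k + 3) u, tr (k + 3) (y * steinbergSeq d (k + 3) u i) = 0 := by
  induction k with
  | zero =>
    intro i hi y
    obtain rfl : i = 0 := by omega
    have : framSpan d u ≤ LinearMap.ker (tr 3) := by
      refine Submodule.span_le.2 ?_
      rintro _ ⟨a, b, c, rfl⟩
      exact (h.trace_framMon_steinbergSeq a b c).trans (hT a b c)
    exact this (mul_steinbergSeq_mem_framSpan y)
  | succ k ih =>
    have hlow : ∀ i, i < k + 1 → ∀ y : Y d (k + 4) u,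
        tr (k + 4) (y * steinbergSeq d (k + 4) u i) = 0 := fun i hi y => by
      rw [← incl_steinbergSeq (by omega)]
      refine mem_of_bimodule (LinearMap.ker ((tr (k + 4)).comp (LinearMap.mulRight ℂ
        (incl d (k + 3) u (steinbergSeq d (k + 3) u i))))) (fun a b m => ?_) (fun j hj a b => ?_) y
      · have := h.framing (k + 3) a (b * steinbergSeq d (k + 3) u i) m
        rw [← mul_assoc a, ih i hi, mul_zero, _root_.map_mul (incl d _ u), ← mul_assoc] at this
        exact this
      · have := h.braid (k + 3) j hj a (b * steinbergSeq d (k + 3) u i)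
        rw [← mul_assoc a, ih i hi, mul_zero, _root_.map_mul (incl d _ u), ← mul_assoc] at this
        exact this
    intro i hi y
    rcases Nat.lt_or_eq_of_le (show i ≤ k + 1 by omega) with hi | rfl
    · exact hlow i hi y
    obtain ⟨w₁, h₁⟩ := exists_G_mul_eq_one (d := d) hu (show k + 1 < k + 4 by omega)
    obtain ⟨w₂, h₂⟩ := exists_G_mul_eq_one (d := d) hu (show k + 1 + 1 < k + 4 by omega)
    obtain ⟨w₃, h₃⟩ := exists_G_mul_eq_one (d := d) hu (show k + 1 + 1 + 1 < k + 4 by omega)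
    have hw : G d (k + 4) u k * G d (k + 4) u (k + 1) * G d (k + 4) u (k + 1 + 1) *
        (w₃ * w₂ * w₁) = 1 := by
      rw [mul_assoc, ← mul_assoc _ (w₃ * w₂), ← mul_assoc _ w₃, h₃, one_mul, mul_assoc,
        ← mul_assoc _ w₂, h₂, one_mul, h₁]
    have hs := semiconj_steinbergSeq (d := d) (u := u) (show k + 3 < k + 4 by omega)
    have e : y * steinbergSeq d (k + 4) u (k + 1) = y * (G d (k + 4) u k * G d (k + 4) u (k + 1) *
        G d (k + 4) u (k + 1 + 1)) * steinbergSeq d (k + 4) u k * (w₃ * w₂ * w₁) := by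
      rw [mul_assoc y _ (steinbergSeq d (k + 4) u k), hs.eq, mul_assoc y (_ * _),
        mul_assoc (steinbergSeq _ _ _ _), hw, mul_one]
    exact (congrArg _ e).trans ((h.comm _ _ _).trans (by
      rw [← mul_assoc]; exact hlow k (by omega) _))

theorem IsMarkov.steinbergTrace_eq_zero (h : IsMarkov d u z x tr) (hx : x 0 = 1) (k : ℕ)
    (hk : ∀ y : Y d (k + 3) u, tr (k + 3) (y * steinbergSeq d (k + 3) u 0) = 0) (a b c : ZMod d) :
    steinbergTrace u z x a b c = 0 := by
  have : ∀ y : Y d 3 u, tr 3 (y * steinbergSeq d 3 u 0) = 0 := by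
    induction k with
    | zero => exact hk
    | succ k ih =>
      refine ih fun y => ?_
      rw [← h.compat hx (k + 3), _root_.map_mul (incl d _ u), incl_steinbergSeq (by omega)]
      exact hk _
  rw [← h.trace_framMon_steinbergSeq, this]

/-- The trace passes to the quotient if and only if it vanishes on the elements
`t_0^a t_1^b t_2^c g_{0,1}`. -/
theorem IsMarkov.passesToYTL_iff (h : IsMarkov d u z x tr) (hx : x 0 = 1) (hu : u ≠ 0)
    (hn : 3 ≤ n) :
    PassesToYTL d n u (tr n) ↔ ∀ a b c : ZMod d, steinbergTrace u z x a b c = 0 := by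
  obtain ⟨k, rfl⟩ : ∃ k, n = k + 3 := ⟨n - 3, by omega⟩
  rw [YokonumaHecke.passesToYTL_iff (h.comm _)]
  constructor
  · intro H
    refine h.steinbergTrace_eq_zero hx k fun y => ?_
    rw [← steinberg_eq (by omega)]
    exact H 0 _ y
  · intro H i hi y
    rw [steinberg_eq]
    exact h.trace_mul_steinbergSeq hu H k i (by omega) y

end Vanishing

/-! ### Solving the equations -/

section Solve

variable {d : ℕ} [NeZero d] {u z : ℂ} {x : ZMod d → ℂ}

theorem dexp_eq_root (k : ℕ) : dexp d k = root d (k : ZMod d) := by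
  have := ZMod.stdAddChar_coe (N := d) (k : ℤ)
  rw [Int.cast_natCast, Int.cast_natCast] at this
  rw [dexp, root, this]

theorem exists_root_eq {α : ℂ} (h : α ^ d = 1) : ∃ m : ℕ, m ≤ d - 1 ∧ α = root d (m : ZMod d) := by
  obtain ⟨m, hm, rfl⟩ :=
    (Complex.isPrimitiveRoot_exp d (NeZero.ne d)).eq_pow_of_pow_eq_one h
  refine ⟨m, Nat.le_sub_one_of_lt hm, ?_⟩
  rw [← dexp_eq_root, dexp, ← Complex.exp_nat_mul]
  congr 1
  ring

theorem forall_zmod_iff {p : ZMod d → Prop} :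
    (∀ l : ℕ, l ≤ d - 1 → p (l : ZMod d)) ↔ ∀ a, p a := by
  refine ⟨fun h a => ?_, fun h l _ => h l⟩
  rw [← ZMod.natCast_zmod_val a]
  exact h _ (Nat.le_sub_one_of_lt (ZMod.val_lt a))

theorem eq_dexp_iff (m : ℕ) : (∀ l : ℕ, l ≤ d - 1 → x (l : ZMod d) = dexp d (l * m)) ↔
    ∀ a, x a = root d (a * m) := by
  rw [← forall_zmod_iff]
  simp only [dexp_eq_root, Nat.cast_mul]

theorem eq_dexp_add_dexp_iff (m₁ m₂ : ℕ) : (∀ l : ℕ, l ≤ d - 1 →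
      x (l : ZMod d) = (1 / 2) * (dexp d (l * m₁) + dexp d (l * m₂))) ↔
    ∀ a, x a = (1 / 2) * (root d (a * m₁) + root d (a * m₂)) := by
  rw [← forall_zmod_iff]
  simp only [dexp_eq_root, Nat.cast_mul]

theorem ESum_of_root {m : ZMod d} (h : ∀ a, x a = root d (a * m)) (a : ZMod d) :
    ESum d x a = x a := by
  have : ∀ s : ZMod d, x (a + s) * x (-s) = x a := fun s => by
    rw [h, h, h, ← root_add, ← add_mul, add_neg_cancel_right]
  simp only [ESum, this, Finset.sum_const, Finset.card_univ, ZMod.card, nsmul_eq_mul]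
  rw [← mul_assoc, one_div, inv_mul_cancel₀ natCast_ne_zero_complex, one_mul]

theorem ESum_of_root_add_root {m₁ m₂ : ZMod d} (hm : m₁ ≠ m₂)
    (h : ∀ a, x a = (1 / 2) * (root d (a * m₁) + root d (a * m₂))) (a : ZMod d) :
    ESum d x a = (1 / 2) * x a := by
  have hs : ∀ s : ZMod d, x (a + s) * x (-s) = (1 / 2) * x a +
      ((1 / 4) * root d (a * m₁) * root d (s * (m₁ - m₂)) +
        (1 / 4) * root d (a * m₂) * root d (s * (m₂ - m₁))) := fun s => by
    have e : ∀ m : ZMod d, root d (s * m) * root d (-s * m) = 1 := fun m => by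
      rw [← root_add, ← add_mul, add_neg_cancel, zero_mul, root_zero]
    have e' : ∀ m m' : ZMod d, root d (s * (m - m')) = root d (s * m) * root d (-s * m') :=
      fun m m' => by rw [← root_add]; congr 1; ring
    rw [h, h, h, e', e', add_mul, add_mul, root_add, root_add]
    linear_combination (1 / 4 : ℂ) * root d (a * m₁) * e m₁ + (1 / 4 : ℂ) * root d (a * m₂) * e m₂
  simp only [ESum, hs, Finset.sum_add_distrib, ← Finset.mul_sum, sum_root_mul, sub_eq_zero,
    if_neg hm, if_neg hm.symm, mul_zero, add_zero, Finset.sum_const, Finset.card_univ, ZMod.card,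
    nsmul_eq_mul]
  have hd := natCast_ne_zero_complex (d := d)
  field_simp

theorem isESolution_of_root {m : ZMod d} (h : ∀ a, x a = root d (a * m)) : IsESolution d x := by
  intro a _
  rw [ESum_of_root h, ESum_of_root h, h 0, zero_mul, root_zero, mul_one]

theorem isESolution_of_root_add_root {m₁ m₂ : ZMod d} (hm : m₁ ≠ m₂)
    (h : ∀ a, x a = (1 / 2) * (root d (a * m₁) + root d (a * m₂))) : IsESolution d x := by
  intro a _
  rw [ESum_of_root_add_root hm h, ESum_of_root_add_root hm h, h 0, zero_mul, zero_mul, root_zero]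
  ring

/-- In this symmetric form the last two terms depend only on `a + b + c`, so they cancel between
equations with equal sum. -/
theorem steinbergTrace_eq (a b c : ZMod d) : steinbergTrace u z x a b c =
    x a * x b * x c + z * (x (a + b) * x c + x a * x (b + c) + x b * x (a + c)) +
      (2 * z ^ 2 + (u - 1) * z ^ 2) * x (a + b + c) + (u - 1) * z * ESum d x (a + b + c) := by
  have : ESum d x (a + b + c) = (1 / (d : ℂ)) * ∑ s : ZMod d, x (b - s) * x (a + c + s) := by
    rw [ESum, ← Equiv.sum_comp (Equiv.addRight (-b))]
    congr 1
    refine Finset.sum_congr rfl fun s _ => ?_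
    rw [Equiv.coe_addRight, mul_comm]
    congr 2 <;> ring
  rw [this, steinbergTrace]
  ring

theorem steinbergTrace_of_root {m : ZMod d} (h : ∀ a, x a = root d (a * m)) (a b c : ZMod d) :
    steinbergTrace u z x a b c = (1 + z) * (1 + (u + 1) * z) * x (a + b + c) := by
  have hadd : ∀ a b, x (a + b) = x a * x b := fun a b => by rw [h, h, h, add_mul, root_add]
  rw [steinbergTrace_eq, ESum_of_root h]
  simp only [hadd]
  ring

theorem steinbergTrace_of_root_add_root {m₁ m₂ : ZMod d} (hm : m₁ ≠ m₂)
    (h : ∀ a, x a = (1 / 2) * (root d (a * m₁) + root d (a * m₂))) (hz : z = -1 / 2)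
    (a b c : ZMod d) : steinbergTrace u z x a b c = 0 := by
  rw [steinbergTrace_eq, ESum_of_root_add_root hm h, hz]
  simp only [h, add_mul, root_add]
  ring

theorem root_case {m : ZMod d} (h : ∀ a, x a = root d (a * m))
    (hT : steinbergTrace u z x 0 0 0 = 0) : (u ≠ -1 ∧ z = -1 / (u + 1)) ∨ z = -1 := by
  rw [steinbergTrace_of_root h, add_zero, add_zero, h 0, zero_mul, root_zero, mul_one] at hT
  rcases mul_eq_zero.1 hT with h1 | h1
  · exact Or.inr (by linear_combination h1)
  · have hu : u + 1 ≠ 0 := fun hu => by simp [hu] at h1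
    refine Or.inl ⟨fun h' => hu (by rw [h']; ring), ?_⟩
    rw [eq_div_iff hu]
    linear_combination h1

theorem root_case_iff {m : ZMod d} (h : ∀ a, x a = root d (a * m))
    (hz : (u ≠ -1 ∧ z = -1 / (u + 1)) ∨ z = -1) (a b c : ZMod d) :
    steinbergTrace u z x a b c = 0 := by
  rw [steinbergTrace_of_root h]
  rcases hz with ⟨hu, rfl⟩ | rfl
  · have hu : u + 1 ≠ 0 := fun h' => hu (by linear_combination h')
    have : 1 + (u + 1) * (-1 / (u + 1)) = 0 := by field_simp; ring
    rw [this]; ring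
  · ring

/-- Multiplicativity gives `x_l = x_1^l`, and `x_1` is a `d`-th root of unity since `x_d = x_0 = 1`.
-/
theorem exists_root_of_mul (hx : x 0 = 1) (h : ∀ a b, x (a + b) = x a * x b) :
    ∃ m : ℕ, m ≤ d - 1 ∧ ∀ a, x a = root d (a * m) := by
  have hpow : ∀ l : ℕ, x (l : ZMod d) = x 1 ^ l := by
    intro l
    induction l with
    | zero => simp [hx]
    | succ l ih => rw [Nat.cast_succ, h, ih, pow_succ]
  obtain ⟨m, hm, hmx⟩ := exists_root_eq (d := d) (α := x 1) (by rw [← hpow]; simp [hx])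
  refine ⟨m, hm, fun a => ?_⟩
  rw [← ZMod.natCast_zmod_val a, hpow, hmx, root_pow, mul_comm]

/-- A function satisfying the identity of two-dimensional pseudocharacters is an average of two
characters. -/
theorem exists_roots_of_pseudo (hx : x 0 = 1)
    (h : ∀ a b c, 2 * (x a * x b * x c) - (x (a + b) * x c + x a * x (b + c) + x b * x (a + c)) +
      x (a + b + c) = 0) :
    ∃ m₁ m₂ : ℕ, m₁ ≤ d - 1 ∧ m₂ ≤ d - 1 ∧
      ∀ a, x a = (1 / 2) * (root d (a * m₁) + root d (a * m₂)) := by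
  -- The identity at `(a, 1, 1)` is a linear recurrence with characteristic polynomial `X^2 - 2 x_1
  -- X + (2 x_1^2 - x_2)`, whose roots are `x_1 ± δ`.
  obtain ⟨δ, hδ⟩ := IsAlgClosed.exists_pow_nat_eq (x (1 + 1) - x 1 ^ 2) (n := 2) two_pos
  have hrec : ∀ a, x (a + 1 + 1) = 2 * x 1 * x (a + 1) - (2 * x 1 ^ 2 - x (1 + 1)) * x a :=
    fun a => by linear_combination h a 1 1
  have key : ∀ l : ℕ, x (l : ZMod d) = (1 / 2) * ((x 1 + δ) ^ l + (x 1 - δ) ^ l) ∧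
      x ((l : ZMod d) + 1) = (1 / 2) * ((x 1 + δ) ^ (l + 1) + (x 1 - δ) ^ (l + 1)) := by
    intro l
    induction l with
    | zero =>
      constructor
      · norm_num [hx]
      · rw [Nat.cast_zero, zero_add]; ring
    | succ l ih =>
      refine ⟨by rw [Nat.cast_succ]; exact ih.2, ?_⟩
      rw [Nat.cast_succ, hrec, ih.1, ih.2]
      linear_combination (-(1 / 2) * ((x 1 + δ) ^ l + (x 1 - δ) ^ l)) * hδ
  -- Periodicity at `d` and `2d` gives `A + B = 2` and `A^2 + B^2 = 2`, so `(A - B)^2 = 0` and `A =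
  -- B = 1`: both characteristic roots are `d`-th roots of unity.
  have h1 := (key d).1
  have h2 := (key (d + d)).1
  rw [Nat.cast_add, CharP.cast_eq_zero, add_zero, hx] at h2
  rw [CharP.cast_eq_zero, hx] at h1
  rw [pow_add, pow_add] at h2
  set A := (x 1 + δ) ^ d with hA
  set B := (x 1 - δ) ^ d with hB
  have hAB : A - B = 0 := by
    refine pow_eq_zero_iff two_ne_zero |>.1 ?_
    linear_combination (-4 : ℂ) * h2 + 4 * h1 + 2 * (A + B) * h1
  obtain ⟨m₁, hm₁, e₁⟩ := exists_root_eq (d := d) (α := x 1 + δ)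
    (by rw [← hA]; linear_combination -h1 + (1 / 2 : ℂ) * hAB)
  obtain ⟨m₂, hm₂, e₂⟩ := exists_root_eq (d := d) (α := x 1 - δ)
    (by rw [← hB]; linear_combination -h1 - (1 / 2 : ℂ) * hAB)
  refine ⟨m₁, m₂, hm₁, hm₂, fun a => ?_⟩
  rw [← ZMod.natCast_zmod_val a, (key _).1, e₁, e₂, root_pow, root_pow, mul_comm (m₁ : ZMod d),
    mul_comm (m₂ : ZMod d)]

theorem natCast_ne_of_le {m₁ m₂ : ℕ} (h₁ : m₁ ≤ d - 1) (h₂ : m₂ ≤ d - 1) (h : m₁ ≠ m₂) :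
    (m₁ : ZMod d) ≠ (m₂ : ZMod d) := by
  have hd := Nat.pos_of_ne_zero (NeZero.ne d)
  intro h'
  have := congrArg ZMod.val h'
  rw [ZMod.val_cast_of_lt (by omega), ZMod.val_cast_of_lt (by omega)] at this
  exact h this

theorem steinbergTrace_eq_zero_cases (hx : x 0 = 1)
    (hT : ∀ a b c : ZMod d, steinbergTrace u z x a b c = 0) :
    (∃ m : ℕ, m ≤ d - 1 ∧ ∀ a, x a = root d (a * m)) ∨
      ∃ m₁ m₂ : ℕ, m₁ ≤ d - 1 ∧ m₂ ≤ d - 1 ∧ m₁ ≠ m₂ ∧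
        (∀ a, x a = (1 / 2) * (root d (a * m₁) + root d (a * m₂))) ∧ z = -1 / 2 := by
  by_cases hz : 1 + 2 * z = 0
  · have hz' : z = -1 / 2 := by linear_combination (1 / 2 : ℂ) * hz
    -- The equation at `(a, 0, 0)` eliminates `E` without dividing by `u - 1`. What remains of the
    -- general equation no longer involves `u` and is the pseudocharacter identity for `2x`.
    have hE : ∀ a, (u - 1) * ESum d x a = (u - 1) * (1 / 2) * x a := fun a => by
      have := hT a 0 0
      rw [steinbergTrace_eq] at this
      simp only [add_zero, hx, hz'] at this
      linear_combination (-2 : ℂ) * this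
    obtain ⟨m₁, m₂, hm₁, hm₂, h⟩ := exists_roots_of_pseudo hx fun a b c => by
      have := hT a b c
      rw [steinbergTrace_eq, hz'] at this
      linear_combination (2 : ℂ) * this + hE (a + b + c)
    -- If the two characters coincide, their average is a single character and belongs to the first
    -- alternative.
    by_cases hm : m₁ = m₂
    · subst hm
      exact Or.inl ⟨m₁, hm₁, fun a => by rw [h]; ring⟩
    · exact Or.inr ⟨m₁, m₂, hm₁, hm₂, hm, h, hz'⟩
  · refine Or.inl (exists_root_of_mul hx fun a b => ?_)
    -- Both equations have index sum `a + b`, so their difference is `(1 + 2z)(x_{a+b} - x_a x_b) =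
    -- 0`.
    have h1 := hT a b 0
    have h2 := hT (a + b) 0 0
    rw [steinbergTrace_eq] at h1 h2
    simp only [add_zero, hx] at h1 h2
    refine mul_left_cancel₀ hz ?_
    linear_combination h2 - h1

end Solve

end YokonumaHecke

end

/-! ### The main theorem -/

open YokonumaHecke

theorem mainTheorem4 (d : ℕ) [NeZero d] (n : ℕ) (hn : 3 ≤ n) (u : ℂ) (hu : u ≠ 0)
    (z : ℂ) (x : ZMod d → ℂ) (hx : x 0 = 1) :
    (∃! tr : (k : ℕ) → YokonumaHecke.Y d k u →ₗ[ℂ] ℂ,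
      YokonumaHecke.IsJuyumayaTrace d u z x tr) ∧
    ∀ tr : (k : ℕ) → YokonumaHecke.Y d k u →ₗ[ℂ] ℂ,
      YokonumaHecke.IsJuyumayaTrace d u z x tr →
      (YokonumaHecke.PassesToYTL d n u (tr n) ↔
        YokonumaHecke.IsESolution d x ∧
        ((∃ m₁ : ℕ, m₁ ≤ d - 1 ∧
            (∀ l : ℕ, l ≤ d - 1 → x (l : ZMod d) = YokonumaHecke.dexp d (l * m₁)) ∧
            (∀ l : ZMod d, x l ^ d = 1) ∧
            ((u ≠ -1 ∧ z = -1 / (u + 1)) ∨ z = -1)) ∨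
         (∃ m₁ m₂ : ℕ, m₁ ≤ d - 1 ∧ m₂ ≤ d - 1 ∧ m₁ ≠ m₂ ∧
            (∀ l : ℕ, l ≤ d - 1 → x (l : ZMod d) =
              (1 / 2) * (YokonumaHecke.dexp d (l * m₁) + YokonumaHecke.dexp d (l * m₂))) ∧
            z = -1 / 2))) := by
  refine ⟨existsUnique_isJuyumayaTrace u z hx, fun tr htr => ?_⟩
  rw [(htr.isMarkov hx).passesToYTL_iff hx hu hn]
  simp only [eq_dexp_iff, eq_dexp_add_dexp_iff]
  constructor
  · intro hT
    rcases steinbergTrace_eq_zero_cases hx hT with ⟨m, hm, h⟩ | ⟨m₁, m₂, hm₁, hm₂, hm, h, hz⟩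
    · exact ⟨isESolution_of_root h, Or.inl ⟨m, hm, h,
        -- For a character the equation at `(0, 0, 0)` alone fixes `z`: it reads `(1 + z)(1 + (u +
        -- 1)z) = 0`.
        fun l => by rw [h]; exact root_pow_eq_one _, root_case h (hT 0 0 0)⟩⟩
    · exact ⟨isESolution_of_root_add_root (natCast_ne_of_le hm₁ hm₂ hm) h,
        Or.inr ⟨m₁, m₂, hm₁, hm₂, hm, h, hz⟩⟩
  · rintro ⟨-, ⟨m, -, h, -, hz⟩ | ⟨m₁, m₂, hm₁, hm₂, hm, h, hz⟩⟩
    · exact root_case_iff h hz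
    · exact steinbergTrace_of_root_add_root (natCast_ne_of_le hm₁ hm₂ hm) h hz
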